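/- Let $X$ be a spectrally negative Lévy process without monotone paths, with Laplace exponent \[ \psi(\lambda)=-\mu\lambda+\frac{\sigma^2}{2}\lambda^2+\int_{(-\infty,0)}\bigl(e^{\lambda x}-1-\lambda x\mathbf 1_{\{|x|<1\}}\bigr)\,\Pi(dx),\qquad \lambda\ge 0, \] where $\mu,\sigma\in\mathbb R$ and $\Pi$ is a measure carried by $(-\infty,0)$ with $\int(1\wedge x^2)\,\Pi(dx)<\infty$. For $q\ge 0$ let $\Phi(q)=\sup\{\lambda\ge 0:\psi(\lambda)=q\}$, and let $W^{(q)}:\mathbb R\to[0,\infty)$ be the $q$-scale function of $X$: the function that vanishes on $(-\infty,0)$, is right continuous on $[0,\infty)$ and satisfies $\int_0^\infty e^{-\beta x}W^{(q)}(x)\,dx=1/(\psi(\beta)-q)$ for all $\beta>\Phi(q)$. When $\sigma=0$ and $\int_{(-1,0)}|x|\,\Pi(dx)<\infty$, so that $X$ has paths of bounded variation, write $X_t=\delta t-S_t$ with $S$ a pure jump subordinator and $\delta=-\mu-\int_{(-1,0)}x\,\Pi(dx)>0$. Then for every $q\ge 0$ the right derivative $W^{(q)\prime}(0+)=\lim_{x\downarrow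 0}\bigl(W^{(q)}(x)-W^{(q)}(0)\bigr)/x$ exists in $[0,\infty]$, and \[ W^{(q)\prime}(0+)=\begin{cases}2/\sigma^2,&\text{if }\sigma\ne 0\text{ or }\Pi(-\infty,0)=\infty,\\[2pt] \bigl(\Pi(-\infty,0)+q\bigr)/\delta^2,&\text{if }\sigma=0\text{ and }\Pi(-\infty,0)<\infty,\end{cases} \] where the first case is understood to be $+\infty$ when $\sigma=0$. -/

import Mathlib

open MeasureTheory Set Filter Topology

noncomputable section

/-- The law of a (real) spectrally negative Lévy process whose paths are not monotone, given by its
Lévy–Khintchine triplet `(μ, σ, Π)`, for the truncation function `x 𝟙_{|x| < 1}`. -/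
structure SpectrallyNegativeLevy where
  /-- the linear coefficient `μ` of the characteristic exponent -/
  mu : ℝ
  /-- the Gaussian coefficient `σ` -/
  sigma : ℝ
  /-- the Lévy measure `Π` -/
  jump : Measure ℝ
  /-- `Π` is carried by `(-∞, 0)`: no mass at `0` and no positive jumps -/
  jump_Ici : jump (Ici 0) = 0
  /-- `∫ (1 ∧ x²) Π(dx) < ∞` -/
  lintegral_jump_lt_top : ∫⁻ x, ENNReal.ofReal (min 1 (x ^ 2)) ∂jump < ⊤
  /-- The paths are not monotone. Either they have unbounded variation (`σ ≠ 0` or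
  `∫_{(-1,0)} |x| Π(dx) = ∞`), or the process is a strictly positive linear drift minus a nonzero
  pure jump subordinator. What is excluded is the case of bounded variation with either no jumps
  (a pure drift) or a nonpositive drift (a descending subordinator). -/
  not_monotone : sigma ≠ 0 ∨ ∫⁻ x in Ioo (-1) 0, ENNReal.ofReal |x| ∂jump = ⊤ ∨
    (0 < -mu - ∫ x in Ioo (-1) 0, x ∂jump ∧ jump ≠ 0)

namespace SpectrallyNegativeLevy

/-- The Laplace exponent
`ψ(l) = -μ l + σ² l² / 2 + ∫_{(-∞,0)} (e^{l x} - 1 - l x 𝟙_{|x| < 1}) Π(dx)`, for `l ≥ 0`;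
it satisfies `E[exp (l X_t)] = exp (t ψ(l))`. -/
def laplaceExponent (X : SpectrallyNegativeLevy) (l : ℝ) : ℝ :=
  -X.mu * l + X.sigma ^ 2 / 2 * l ^ 2 +
    ∫ x in Iio 0, (Real.exp (l * x) - 1 - l * x * indicator {y : ℝ | |y| < 1} 1 x) ∂X.jump

/-- `Φ(q) = sup {l ≥ 0 : ψ(l) = q}`. -/
def rightInverse (X : SpectrallyNegativeLevy) (q : ℝ) : ℝ :=
  sSup {l : ℝ | 0 ≤ l ∧ X.laplaceExponent l = q}

/-- The drift `δ = -μ - ∫_{(-1,0)} x Π(dx)` in the decomposition `X_t = δ t - S_t` of a process of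
bounded variation (`σ = 0` and `∫_{(-1,0)} |x| Π(dx) < ∞`), where `S` is a pure jump subordinator;
then `ψ(l) = δ l - ∫_{(-∞,0)} (1 - e^{l x}) Π(dx)`. It is only used for such processes. -/
def drift (X : SpectrallyNegativeLevy) : ℝ :=
  -X.mu - ∫ x in Ioo (-1) 0, x ∂X.jump

/-- `W` is the `q`-scale function of `X`: it takes values in `[0, ∞)`, vanishes on `(-∞, 0)`, is
right continuous on `[0, ∞)`, and has the (convergent) Laplace transform `1 / (ψ(β) - q)` for all
`β > Φ(q)`. These properties determine `W`. -/
structure IsScaleFunction (X : SpectrallyNegativeLevy) (q : ℝ) (W : ℝ → ℝ) : Prop where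
  nonneg : ∀ x, 0 ≤ W x
  eq_zero_of_neg : ∀ x < 0, W x = 0
  rightContinuous : ∀ x, 0 ≤ x → ContinuousWithinAt W (Ici x) x
  integrableOn : ∀ b, X.rightInverse q < b →
    IntegrableOn (fun x => Real.exp (-b * x) * W x) (Ioi 0)
  laplace_eq : ∀ b, X.rightInverse q < b →
    ∫ x in Ioi 0, Real.exp (-b * x) * W x = 1 / (X.laplaceExponent b - q)

end SpectrallyNegativeLevy

end

/-! The transform of `W` is 1/(ψ - q), so writing ψ - q through transforms of nonnegative kernels
turns it into a renewal equation for `W`, from which the behaviour at 0 is read off.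

For bounded variation with σ = 0, ψ(b) - q = b(δ - k̂(b)) with k(y) = Π(-∞,-y) + q (`lap_bvKernel`),
hence δW = 1 + k∗W (`renewal_bv`). Thus W(0) = 1/δ, and (W(x) - W(0))/x = (k∗W)(x)/(δx) tends to
k(0+)W(0)/δ = (Π(-∞,0) + q)/δ², possibly infinite (`bv_limit`).

In general ψ(b) - q = b²(σ²/2 + L̂(b) - R̂(b)) (`lap_kernels`), hence (σ²/2)W + L∗W = x + R∗W
(`renewal`), with L and R integrable near 0. If σ ≠ 0, both convolutions are o(x), by absorbing them
into the supremum of W over (0,x) (`gaussian_bound`). If σ = 0 and the variation is unbounded, L(0+)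
= ∞. Granted that W is nondecreasing, this forces W(0) = 0, and x ≤ W(x)∫₀ˣL then makes W(x)/x blow
up (`tendsto_uv`).

Monotonicity of W is not part of the definition. Deleting the small jumps gives processes of bounded
variation whose renewal functions are limits of Neumann series of nondecreasing functions. Their
transforms converge to that of W, and monotonicity survives weak limits (`uv_mem_closure`,
`monotoneOn_of_mem_closure`). -/

open scoped ENNReal

noncomputable section

/-! ### Laplace transforms and convolutions on the half-line. -/

/-- The Laplace transform of a nonnegative function on `(0, ∞)`. -/
def lap (f : ℝ → ℝ≥0∞) (b : ℝ) : ℝ≥0∞ :=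
  ∫⁻ x in Ioi 0, ENNReal.ofReal (Real.exp (-b * x)) * f x

/-- The convolution of two nonnegative functions on `(0, ∞)`. -/
def lconv (f g : ℝ → ℝ≥0∞) (x : ℝ) : ℝ≥0∞ :=
  ∫⁻ y in Ioo 0 x, f y * g (x - y)

theorem measurable_exp_weight (b : ℝ) :
    Measurable fun x : ℝ => ENNReal.ofReal (Real.exp (-b * x)) := by fun_prop

theorem measurable_exp_weight_mul {f : ℝ → ℝ≥0∞} (hf : Measurable f) (b : ℝ) :
    Measurable fun x : ℝ => ENNReal.ofReal (Real.exp (-b * x)) * f x :=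
  (measurable_exp_weight b).mul hf

theorem lap_add {f : ℝ → ℝ≥0∞} (hf : Measurable f) (g : ℝ → ℝ≥0∞) (b : ℝ) :
    lap (fun x => f x + g x) b = lap f b + lap g b := by
  unfold lap
  rw [← lintegral_add_left (measurable_exp_weight_mul hf b)]
  simp only [mul_add]

theorem lap_const_mul {f : ℝ → ℝ≥0∞} (hf : Measurable f) (c : ℝ≥0∞) (b : ℝ) :
    lap (fun x => c * f x) b = c * lap f b := by
  unfold lap
  rw [← lintegral_const_mul _ (measurable_exp_weight_mul hf b)]
  simp only [mul_left_comm]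

theorem lap_congr {f g : ℝ → ℝ≥0∞} (h : ∀ x, 0 < x → f x = g x) (b : ℝ) : lap f b = lap g b :=
  setLIntegral_congr_fun measurableSet_Ioi fun x hx => by simp only [h x hx]

theorem lap_antitone (f : ℝ → ℝ≥0∞) : Antitone (lap f) := by
  intro a b hab
  refine setLIntegral_mono' measurableSet_Ioi fun x hx => ?_
  have : (0:ℝ) < x := hx
  gcongr

/-- Extension by zero turns this into a convolution on the whole line, where translation invariance
of Lebesgue measure and Tonelli apply directly. -/
theorem lconv_eq (f g : ℝ → ℝ≥0∞) (x : ℝ) : lconv f g x =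
    ∫⁻ y, (Ioi 0).indicator f y * (Ioi 0).indicator g (x - y) := by
  unfold lconv
  rw [← lintegral_indicator measurableSet_Ioo]
  congr 1
  ext y
  by_cases h1 : 0 < y <;> by_cases h2 : y < x <;> simp [h1, h2]

theorem measurable_lconv {f g : ℝ → ℝ≥0∞} (hf : Measurable f) (hg : Measurable g) :
    Measurable (lconv f g) := by
  have : lconv f g = fun x => ∫⁻ y, (Ioi 0).indicator f y * (Ioi 0).indicator g (x - y) :=
    funext (lconv_eq f g)
  rw [this]
  refine Measurable.lintegral_prod_right' (ν := volume)
    (f := fun p : ℝ × ℝ => (Ioi 0).indicator f p.2 * (Ioi 0).indicator g (p.1 - p.2)) ?_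
  exact ((hf.indicator measurableSet_Ioi).comp measurable_snd).mul
    ((hg.indicator measurableSet_Ioi).comp (measurable_fst.sub measurable_snd))

theorem lap_eq (f : ℝ → ℝ≥0∞) (b : ℝ) : lap f b =
    ∫⁻ x, ENNReal.ofReal (Real.exp (-b * x)) * (Ioi 0).indicator f x := by
  unfold lap
  rw [← lintegral_indicator measurableSet_Ioi]
  congr 1
  ext y
  by_cases h1 : 0 < y <;> simp [h1]

theorem lap_lconv {f g : ℝ → ℝ≥0∞} (hf : Measurable f) (hg : Measurable g) (b : ℝ) :
    lap (lconv f g) b = lap f b * lap g b := by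
  have hf' := hf.indicator (measurableSet_Ioi (a := (0:ℝ)))
  have hg' := hg.indicator (measurableSet_Ioi (a := (0:ℝ)))
  have hw := measurable_exp_weight b
  calc lap (lconv f g) b
      = ∫⁻ x, ∫⁻ y, (ENNReal.ofReal (Real.exp (-b * y)) * (Ioi 0).indicator f y) *
          (ENNReal.ofReal (Real.exp (-b * (x - y))) * (Ioi 0).indicator g (x - y)) := by
        rw [lap_eq]
        congr 1
        ext x
        have h0 : (Ioi 0).indicator (lconv f g) x = lconv f g x := by
          by_cases hx : 0 < x
          · simp [hx]
          · simp [hx, lconv]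
        rw [h0, lconv_eq, ← lintegral_const_mul]
        · congr 1
          ext y
          have : ENNReal.ofReal (Real.exp (-b * x)) = ENNReal.ofReal (Real.exp (-b * y)) *
              ENNReal.ofReal (Real.exp (-b * (x - y))) := by
            rw [← ENNReal.ofReal_mul (Real.exp_pos _).le, ← Real.exp_add]
            congr 2
            ring
          rw [this]
          ring
        · exact hf'.mul (hg'.comp (measurable_const.sub measurable_id))
    _ = ∫⁻ y, ∫⁻ x, (ENNReal.ofReal (Real.exp (-b * y)) * (Ioi 0).indicator f y) *
          (ENNReal.ofReal (Real.exp (-b * (x - y))) * (Ioi 0).indicator g (x - y)) := by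
        rw [lintegral_lintegral_swap]
        apply Measurable.aemeasurable
        exact ((hw.mul hf').comp measurable_snd).mul
          ((hw.mul hg').comp (measurable_fst.sub measurable_snd))
    _ = ∫⁻ y, (ENNReal.ofReal (Real.exp (-b * y)) * (Ioi 0).indicator f y) * lap g b := by
        congr 1
        ext y
        rw [lintegral_const_mul]
        · rw [lintegral_sub_right_eq_self
            (fun x => ENNReal.ofReal (Real.exp (-b * x)) * (Ioi 0).indicator g x) y, lap_eq]
        · exact (hw.mul hg').comp (measurable_id.sub measurable_const)
    _ = lap f b * lap g b := by
        rw [lintegral_mul_const _ (measurable_exp_weight_mul hf' b), ← lap_eq]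

theorem lap_one {b : ℝ} (hb : 0 < b) : lap (fun _ => 1) b = ENNReal.ofReal (1 / b) := by
  unfold lap
  simp only [mul_one]
  rw [← ofReal_integral_eq_lintegral_ofReal]
  · have := integral_exp_mul_Ioi (a := -b) (by linarith) 0
    rw [this]
    simp
  · exact integrableOn_exp_mul_Ioi (by linarith) 0
  · exact ae_of_all _ fun x => (Real.exp_pos _).le

theorem lap_const {b : ℝ} (hb : 0 < b) (c : ℝ≥0∞) :
    lap (fun _ => c) b = c * ENNReal.ofReal (1 / b) := by
  have := lap_const_mul (f := fun _ => 1) measurable_const c b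
  simpa [lap_one hb] using this

theorem lconv_one_one (x : ℝ) : lconv (fun _ => 1) (fun _ => 1) x = ENNReal.ofReal x := by
  simp [lconv]

theorem lap_ofReal {b : ℝ} (hb : 0 < b) :
    lap ENNReal.ofReal b = ENNReal.ofReal (1 / b ^ 2) := by
  have h : (ENNReal.ofReal : ℝ → ℝ≥0∞) = lconv (fun _ => 1) (fun _ => 1) :=
    (funext lconv_one_one).symm
  rw [congrArg lap h, lap_lconv measurable_const measurable_const, lap_one hb,
    ← ENNReal.ofReal_mul (by positivity)]
  congr 1
  field_simp

theorem tendsto_lap_zero {f : ℝ → ℝ≥0∞} (hf : Measurable f) {b : ℝ} (hb : lap f b ≠ ⊤) :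
    Tendsto (lap f) atTop (𝓝 0) := by
  have hfin : ∀ᵐ x ∂(volume.restrict (Ioi (0:ℝ))), f x ≠ ⊤ := by
    filter_upwards [ae_lt_top ((measurable_exp_weight b).mul hf) hb] with x hx h
    simp [h, ENNReal.mul_top, Real.exp_pos] at hx
  have := tendsto_lintegral_filter_of_dominated_convergence
    (μ := volume.restrict (Ioi (0:ℝ))) (l := atTop)
    (F := fun c x => ENNReal.ofReal (Real.exp (-c * x)) * f x) (f := fun _ => 0)
    (fun x => ENNReal.ofReal (Real.exp (-b * x)) * f x)
    (Eventually.of_forall fun c => (measurable_exp_weight c).mul hf) ?_ hb ?_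
  · rw [lintegral_zero] at this
    exact this
  · filter_upwards [eventually_ge_atTop b] with c hc
    filter_upwards [ae_restrict_mem measurableSet_Ioi] with x hx
    have : (0:ℝ) < x := hx
    gcongr
  · filter_upwards [hfin, ae_restrict_mem measurableSet_Ioi] with x hx hx0
    have h1 : Tendsto (fun c : ℝ => ENNReal.ofReal (Real.exp (-c * x))) atTop (𝓝 0) := by
      rw [← ENNReal.ofReal_zero]
      refine ENNReal.tendsto_ofReal (Real.tendsto_exp_atBot.comp ?_)
      exact tendsto_neg_atTop_atBot.atBot_mul_const hx0
    simpa using ENNReal.Tendsto.mul_const h1 (Or.inr hx)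

theorem lconv_monotone (k : ℝ → ℝ≥0∞) {w : ℝ → ℝ≥0∞} (hw : Monotone w) :
    Monotone (lconv k w) := by
  intro x y hxy
  calc lconv k w x ≤ ∫⁻ z in Ioo 0 x, k z * w (y - z) := by
        refine lintegral_mono fun z => ?_
        have := hw (show x - z ≤ y - z by linarith)
        gcongr
    _ ≤ lconv k w y := lintegral_mono_set (Ioo_subset_Ioo_right hxy)

/-! ### Moments on [0,1], weak convergence and uniqueness of Laplace transforms. -/

theorem integrable_of_continuous_of_Icc {μ : Measure ℝ} [IsFiniteMeasure μ]
    (hμ : ∀ᵐ t ∂μ, t ∈ Icc (0:ℝ) 1) {φ : ℝ → ℝ} (hφ : Continuous φ) : Integrable φ μ := by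
  obtain ⟨C, hC⟩ := isCompact_Icc.exists_bound_of_continuousOn (hφ.continuousOn (s := Icc (0:ℝ) 1))
  exact Integrable.of_bound hφ.aestronglyMeasurable C (hμ.mono fun t ht => hC t ht)

theorem tendsto_integral_polynomial {ι : Type*} {l : Filter ι} {μs : ι → Measure ℝ} {μ : Measure ℝ}
    [∀ i, IsFiniteMeasure (μs i)] [IsFiniteMeasure μ]
    (hμs : ∀ i, ∀ᵐ t ∂(μs i), t ∈ Icc (0:ℝ) 1) (hμ : ∀ᵐ t ∂μ, t ∈ Icc (0:ℝ) 1)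
    (h : ∀ j : ℕ, Tendsto (fun i => ∫ t, t ^ j ∂(μs i)) l (𝓝 (∫ t, t ^ j ∂μ)))
    (p : Polynomial ℝ) :
    Tendsto (fun i => ∫ t, p.eval t ∂(μs i)) l (𝓝 (∫ t, p.eval t ∂μ)) := by
  have key : ∀ ν : Measure ℝ, IsFiniteMeasure ν → (∀ᵐ t ∂ν, t ∈ Icc (0:ℝ) 1) →
      ∫ t, p.eval t ∂ν = ∑ j ∈ Finset.range (p.natDegree + 1), p.coeff j * ∫ t, t ^ j ∂ν := by
    intro ν _ hν
    simp_rw [Polynomial.eval_eq_sum_range]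
    rw [integral_finsetSum]
    · simp_rw [integral_const_mul]
    · exact fun j _ => integrable_of_continuous_of_Icc hν (by fun_prop)
  simp_rw [fun i => key (μs i) inferInstance (hμs i)]
  rw [key μ inferInstance hμ]
  exact tendsto_finsetSum _ fun j _ => (h j).const_mul _

/-- Convergence of the moments of measures carried by `[0, 1]` implies weak convergence. -/
theorem tendsto_integral_of_tendsto_moments {ι : Type*} {l : Filter ι} {μs : ι → Measure ℝ}
    {μ : Measure ℝ} [∀ i, IsFiniteMeasure (μs i)] [IsFiniteMeasure μ]
    (hμs : ∀ i, ∀ᵐ t ∂(μs i), t ∈ Icc (0:ℝ) 1) (hμ : ∀ᵐ t ∂μ, t ∈ Icc (0:ℝ) 1)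
    (h : ∀ j : ℕ, Tendsto (fun i => ∫ t, t ^ j ∂(μs i)) l (𝓝 (∫ t, t ^ j ∂μ)))
    {φ : ℝ → ℝ} (hφ : Continuous φ) :
    Tendsto (fun i => ∫ t, φ t ∂(μs i)) l (𝓝 (∫ t, φ t ∂μ)) := by
  rw [Metric.tendsto_nhds]
  intro ε hε
  set m := μ.real univ
  have hm : 0 ≤ m := measureReal_nonneg
  have hmass : ∀ᶠ i in l, (μs i).real univ < m + 1 := by
    have := h 0
    simp only [pow_zero, integral_const, smul_eq_mul, mul_one] at this
    exact this.eventually_lt_const (by simp [m])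
  -- The masses are eventually below `m + 1`, so replacing φ by the polynomial costs at most ε/4 for
  -- each measure. Convergence for the polynomial itself costs another ε/4.
  obtain ⟨p, hp⟩ := exists_polynomial_near_of_continuousOn 0 1 φ hφ.continuousOn
    (ε / (4 * (m + 1))) (by positivity)
  have key : ∀ ν : Measure ℝ, IsFiniteMeasure ν → (∀ᵐ t ∂ν, t ∈ Icc (0:ℝ) 1) →
      ν.real univ < m + 1 → |∫ t, p.eval t ∂ν - ∫ t, φ t ∂ν| ≤ ε / 4 := by
    intro ν _ hν hνm
    rw [← integral_sub (integrable_of_continuous_of_Icc hν p.continuous)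
      (integrable_of_continuous_of_Icc hν hφ)]
    have := norm_integral_le_of_norm_le_const (μ := ν) (f := fun t => p.eval t - φ t)
      (hν.mono fun t ht => (hp t ht).le)
    rw [Real.norm_eq_abs] at this
    refine this.trans ?_
    calc ε / (4 * (m + 1)) * ν.real univ ≤ ε / (4 * (m + 1)) * (m + 1) := by gcongr
      _ = ε / 4 := by field_simp
  have hpoly := tendsto_integral_polynomial hμs hμ h p
  rw [Metric.tendsto_nhds] at hpoly
  filter_upwards [hmass, hpoly (ε / 4) (by positivity)] with i hi hi'
  have h1 := key (μs i) inferInstance (hμs i) hi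
  have h2 := key μ inferInstance hμ (by simp [m])
  rw [Real.dist_eq] at hi' ⊢
  rw [abs_le] at h1 h2
  rw [abs_lt] at hi' ⊢
  constructor <;> linarith [h1.1, h1.2, h2.1, h2.2, hi'.1, hi'.2]

/-- The image under `x ↦ exp (-x)` of the measure with density `exp (-b x) f x` on `(0, ∞)`. -/
def expMeasure (f : ℝ → ℝ≥0∞) (b : ℝ) : Measure ℝ :=
  ((volume.restrict (Ioi 0)).withDensity
    fun x => ENNReal.ofReal (Real.exp (-b * x)) * f x).map fun x => Real.exp (-x)

theorem lintegral_expMeasure {f : ℝ → ℝ≥0∞} (hf : Measurable f) (b : ℝ) {g : ℝ → ℝ≥0∞}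
    (hg : Measurable g) : ∫⁻ t, g t ∂(expMeasure f b) =
      ∫⁻ x in Ioi 0, ENNReal.ofReal (Real.exp (-b * x)) * f x * g (Real.exp (-x)) := by
  unfold expMeasure
  rw [lintegral_map hg (by fun_prop), lintegral_withDensity_eq_lintegral_mul _
    (measurable_exp_weight_mul hf b)
    (g := fun x => g (Real.exp (-x))) (hg.comp (by fun_prop))]
  rfl

theorem isFiniteMeasure_expMeasure {f : ℝ → ℝ≥0∞} (hf : Measurable f) {b : ℝ}
    (hb : lap f b ≠ ⊤) : IsFiniteMeasure (expMeasure f b) := by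
  constructor
  rw [← lintegral_one, lintegral_expMeasure hf b measurable_const]
  simpa [lap] using hb.lt_top

theorem ae_expMeasure_mem (f : ℝ → ℝ≥0∞) (b : ℝ) : ∀ᵐ t ∂(expMeasure f b), t ∈ Icc (0:ℝ) 1 := by
  unfold expMeasure
  rw [ae_map_iff (p := fun t => t ∈ Icc (0:ℝ) 1) (by fun_prop) measurableSet_Icc]
  refine (withDensity_absolutelyContinuous _ _).ae_le ?_
  filter_upwards [ae_restrict_mem measurableSet_Ioi] with x hx
  have : (0:ℝ) < x := hx
  exact ⟨(Real.exp_pos _).le, Real.exp_le_one_iff.2 (by linarith)⟩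

/-- With t = exp(-x), the factor t^j shifts the Laplace variable by j. Moments on [0,1] are thus
transform values at b + j, which is why only these points appear below. -/
theorem integral_pow_expMeasure {f : ℝ → ℝ≥0∞} (hf : Measurable f) (b : ℝ) (j : ℕ) :
    ∫ t, t ^ j ∂(expMeasure f b) = (lap f (b + j)).toReal := by
  rw [integral_eq_lintegral_of_nonneg_ae ((ae_expMeasure_mem f b).mono fun t ht => pow_nonneg ht.1 j)
    (by fun_prop), lintegral_expMeasure hf b (by fun_prop)]
  congr 1
  unfold lap
  refine lintegral_congr fun x => ?_
  rw [mul_right_comm, ← ENNReal.ofReal_mul (Real.exp_pos _).le, ← Real.exp_nat_mul, ← Real.exp_add]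
  congr 3
  ring

/-- Convergence of Laplace transforms along `b, b + 1, b + 2, …` implies weak convergence. -/
theorem tendsto_integral_expMeasure {ι : Type*} {l : Filter ι} {fs : ι → ℝ → ℝ≥0∞} {f : ℝ → ℝ≥0∞}
    (hfs : ∀ i, Measurable (fs i)) (hf : Measurable f) {b : ℝ} (hbs : ∀ i, lap (fs i) b ≠ ⊤)
    (hb : lap f b ≠ ⊤)
    (h : ∀ j : ℕ, Tendsto (fun i => lap (fs i) (b + j)) l (𝓝 (lap f (b + j))))
    {φ : ℝ → ℝ} (hφ : Continuous φ) :
    Tendsto (fun i => ∫ t, φ t ∂(expMeasure (fs i) b)) l (𝓝 (∫ t, φ t ∂(expMeasure f b))) := by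
  have := isFiniteMeasure_expMeasure hf hb
  have := fun i => isFiniteMeasure_expMeasure (hfs i) (hbs i)
  refine tendsto_integral_of_tendsto_moments (fun i => ae_expMeasure_mem _ _)
    (ae_expMeasure_mem _ _) (fun j => ?_) hφ
  simp_rw [fun i => integral_pow_expMeasure (hfs i) b j, integral_pow_expMeasure hf b j]
  refine (ENNReal.tendsto_toReal ?_).comp (h j)
  exact ne_top_of_le_ne_top hb (lap_antitone f (by linarith [j.cast_nonneg (α := ℝ)]))

/-- Uniqueness of Laplace transforms. -/
theorem ae_eq_of_lap_eq {f g : ℝ → ℝ≥0∞} (hf : Measurable f) (hg : Measurable g) {b : ℝ}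
    (hb : lap f b ≠ ⊤) (h : ∀ j : ℕ, lap f (b + j) = lap g (b + j)) :
    f =ᵐ[volume.restrict (Ioi 0)] g := by
  have hb' : lap g b ≠ ⊤ := by
    have := h 0
    rw [Nat.cast_zero, add_zero] at this
    rwa [← this]
  have h1 := isFiniteMeasure_expMeasure hf hb
  have h2 := isFiniteMeasure_expMeasure hg hb'
  have heq : expMeasure f b = expMeasure g b := by
    refine ext_of_forall_integral_eq_of_IsFiniteMeasure fun φ => ?_
    have := tendsto_integral_expMeasure (l := (atTop : Filter ℕ)) (fs := fun _ => f)
      (fun _ => hf) hg (fun _ => hb) hb' (fun j => by rw [h j]; exact tendsto_const_nhds) φ.continuous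
    exact tendsto_nhds_unique tendsto_const_nhds this
  -- Pushing forward by -log undoes x ↦ exp(-x) and recovers the densities.
  have hmap := congrArg (fun ν : Measure ℝ => ν.map fun t => -Real.log t) heq
  simp only [expMeasure] at hmap
  rw [Measure.map_map (by fun_prop) (by fun_prop), Measure.map_map (by fun_prop) (by fun_prop)]
    at hmap
  have hid : ((fun t => -Real.log t) ∘ fun x => Real.exp (-x)) = id := by
    ext x
    simp
  rw [hid, Measure.map_id, Measure.map_id] at hmap
  have := (withDensity_eq_iff (measurable_exp_weight_mul hf b).aemeasurable
    (measurable_exp_weight_mul hg b).aemeasurable hb).1 hmap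
  filter_upwards [this] with x hx
  exact (ENNReal.mul_right_inj (by simp [Real.exp_pos]) ENNReal.ofReal_ne_top).1 hx

/-- A test function vanishing beyond `R` becomes a continuous function of t = exp(-x), to which weak
convergence on [0,1] applies. -/
theorem tendsto_lintegral_of_tendsto_lap {ι : Type*} {l : Filter ι} {fs : ι → ℝ → ℝ≥0∞}
    {f : ℝ → ℝ≥0∞} (hfs : ∀ i, Measurable (fs i)) (hf : Measurable f) {b : ℝ}
    (hbs : ∀ i, lap (fs i) b ≠ ⊤) (hb : lap f b ≠ ⊤)
    (h : ∀ j : ℕ, Tendsto (fun i => lap (fs i) (b + j)) l (𝓝 (lap f (b + j))))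
    {F : ℝ → ℝ} (hF : Continuous F) (hF0 : ∀ x, 0 ≤ F x) {R : ℝ} (hFR : ∀ x, R ≤ x → F x = 0) :
    Tendsto (fun i => ∫⁻ x in Ioi 0, fs i x * ENNReal.ofReal (F x)) l
      (𝓝 (∫⁻ x in Ioi 0, f x * ENNReal.ofReal (F x))) := by
  -- Clamping t at exp(-R) keeps -log continuous at t = 0 and changes nothing where `F` is nonzero.
  -- The factor exp(b s) in φ cancels the exponential weight.
  set s : ℝ → ℝ := fun t => -Real.log (max t (Real.exp (-R)))
  set φ : ℝ → ℝ := fun t => F (s t) * Real.exp (b * s t)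
  have hpos : ∀ t, max t (Real.exp (-R)) ≠ 0 := fun t =>
    (lt_max_of_lt_right (Real.exp_pos _)).ne'
  have hs : Continuous s := (Continuous.log (by fun_prop) hpos).neg
  have hφ : Continuous φ := (hF.comp hs).mul (by fun_prop)
  have hφ0 : ∀ t, 0 ≤ φ t := fun t => mul_nonneg (hF0 _) (Real.exp_pos _).le
  have hφe : ∀ x, Real.exp (-b * x) * φ (Real.exp (-x)) = F x := by
    intro x
    rcases le_total x R with hx | hx
    · have : s (Real.exp (-x)) = x := by
        simp only [s]
        rw [max_eq_left (Real.exp_le_exp.2 (by linarith)), Real.log_exp, neg_neg]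
      simp only [φ, this]
      rw [mul_left_comm, ← Real.exp_add]
      simp
    · have : s (Real.exp (-x)) = R := by
        simp only [s]
        rw [max_eq_right (Real.exp_le_exp.2 (by linarith)), Real.log_exp, neg_neg]
      simp only [φ, this, hFR R le_rfl, hFR x hx]
      ring
  have key : ∀ g : ℝ → ℝ≥0∞, Measurable g → lap g b ≠ ⊤ →
      ENNReal.ofReal (∫ t, φ t ∂(expMeasure g b)) =
        ∫⁻ x in Ioi 0, g x * ENNReal.ofReal (F x) := by
    intro g hg hgb
    have := isFiniteMeasure_expMeasure hg hgb
    rw [ofReal_integral_eq_lintegral_ofReal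
      (integrable_of_continuous_of_Icc (ae_expMeasure_mem g b) hφ) (ae_of_all _ hφ0),
      lintegral_expMeasure hg b (by fun_prop)]
    refine lintegral_congr fun x => ?_
    rw [mul_right_comm, ← ENNReal.ofReal_mul (Real.exp_pos _).le, hφe, mul_comm]
  have := ENNReal.tendsto_ofReal (tendsto_integral_expMeasure hfs hf hbs hb h hφ)
  simpa only [key f hf hb, fun i => key (fs i) (hfs i) (hbs i)] using this

/-! ### Tails of the Lévy measure and their transforms. -/

/-- The tail `y ↦ Π (-∞, -y)` of a Lévy measure. -/
def tail (P : Measure ℝ) (y : ℝ) : ℝ≥0∞ := P (Iio (-y))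

/-- The integrated tail `y ↦ ∫_{(-1, 0)} (-x - y)⁺ Π(dx)` of the small jumps. -/
def integratedTail (P : Measure ℝ) (y : ℝ) : ℝ≥0∞ :=
  ∫⁻ x in Ioo (-1) 0, ENNReal.ofReal (-x - y) ∂P

theorem tail_antitone (P : Measure ℝ) : Antitone (tail P) := fun _ _ h =>
  measure_mono (Iio_subset_Iio (neg_le_neg h))

theorem measurable_tail (P : Measure ℝ) : Measurable (tail P) := (tail_antitone P).measurable

theorem integratedTail_antitone (P : Measure ℝ) : Antitone (integratedTail P) := fun _ _ h =>
  lintegral_mono fun _ => ENNReal.ofReal_le_ofReal (by linarith)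

theorem measurable_integratedTail (P : Measure ℝ) : Measurable (integratedTail P) :=
  (integratedTail_antitone P).measurable

theorem lap_lintegral {P : Measure ℝ} [SFinite P] {H : ℝ → ℝ → ℝ≥0∞}
    (hH : Measurable (Function.uncurry H)) (b : ℝ) :
    lap (fun y => ∫⁻ x, H x y ∂P) b = ∫⁻ x, lap (H x) b ∂P := by
  unfold lap
  rw [lintegral_lintegral_swap]
  · refine lintegral_congr fun y => ?_
    rw [lintegral_const_mul]
    exact hH.comp (measurable_id.prodMk measurable_const)
  · apply Measurable.aemeasurable
    exact ((measurable_exp_weight b).comp measurable_snd).mul hH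

theorem lap_indicator_lt {a b : ℝ} (ha : 0 ≤ a) (hb : 0 < b) :
    lap (fun y => if y < a then 1 else 0) b = ENNReal.ofReal ((1 - Real.exp (-b * a)) / b) := by
  have h1 : lap (fun y => if y < a then 1 else 0) b =
      ∫⁻ y in Ioo 0 a, ENNReal.ofReal (Real.exp (-b * y)) := by
    rw [lap_eq, ← lintegral_indicator measurableSet_Ioo]
    congr 1
    ext y
    by_cases h1 : 0 < y <;> by_cases h2 : y < a <;> simp [h1, h2]
  rw [h1, setLIntegral_congr Ioo_ae_eq_Ioc, ← ofReal_integral_eq_lintegral_ofReal]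
  · rw [← intervalIntegral.integral_of_le ha]
    congr 1
    have hd : ∀ y ∈ uIcc 0 a, HasDerivAt (fun y => -(Real.exp (-b * y)) / b)
        (Real.exp (-b * y)) y := by
      intro y _
      have := (((hasDerivAt_id y).const_mul (-b)).exp.neg).div_const b
      refine this.congr_deriv ?_
      simp only [id]
      field_simp
    rw [intervalIntegral.integral_eq_sub_of_hasDerivAt hd
      (Continuous.intervalIntegrable (by fun_prop) _ _)]
    simp
    ring
  · exact (Continuous.integrableOn_Icc (by fun_prop)).mono_set Ioc_subset_Icc_self
  · exact ae_of_all _ fun y => (Real.exp_pos _).le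

theorem lap_ofReal_sub {a b : ℝ} (ha : 0 ≤ a) (hb : 0 < b) :
    lap (fun y => ENNReal.ofReal (a - y)) b =
      ENNReal.ofReal ((Real.exp (-b * a) - 1 + b * a) / b ^ 2) := by
  have h1 : lap (fun y => ENNReal.ofReal (a - y)) b =
      ∫⁻ y in Ioo 0 a, ENNReal.ofReal (Real.exp (-b * y) * (a - y)) := by
    rw [lap_eq, ← lintegral_indicator measurableSet_Ioo]
    congr 1
    ext y
    by_cases h1 : 0 < y <;> by_cases h2 : y < a <;>
      simp [h1, h2, ENNReal.ofReal_mul (Real.exp_pos _).le]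
    exact Or.inr (by linarith)
  rw [h1, setLIntegral_congr Ioo_ae_eq_Ioc, ← ofReal_integral_eq_lintegral_ofReal]
  · rw [← intervalIntegral.integral_of_le ha]
    congr 1
    have hd : ∀ y ∈ uIcc 0 a, HasDerivAt
        (fun y => Real.exp (-b * y) * (-(a - y) / b + 1 / b ^ 2))
        (Real.exp (-b * y) * (a - y)) y := by
      intro y _
      have h2 := ((((hasDerivAt_id y).const_sub a).neg.div_const b).add_const (1 / b ^ 2))
      have := (((hasDerivAt_id y).const_mul (-b)).exp).mul h2
      refine this.congr_deriv ?_
      simp only [id, Pi.neg_apply]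
      field_simp
      ring
    rw [intervalIntegral.integral_eq_sub_of_hasDerivAt hd
      (Continuous.intervalIntegrable (by fun_prop) _ _)]
    simp
    field_simp
    ring
  · exact (Continuous.integrableOn_Icc (by fun_prop)).mono_set Ioc_subset_Icc_self
  · filter_upwards [ae_restrict_mem measurableSet_Ioc] with y hy
    exact mul_nonneg (Real.exp_pos _).le (by linarith [hy.2])

/-- By Tonelli, each jump of size a contributes the transform of the indicator of y < a. -/
theorem lap_tail (P : Measure ℝ) [SFinite P] {b : ℝ} (hb : 0 < b) :
    lap (tail P) b = ∫⁻ x in Iio 0, ENNReal.ofReal ((1 - Real.exp (b * x)) / b) ∂P := by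
  have h1 : lap (tail P) b =
      lap (fun y => ∫⁻ x in Iio 0, (if y < -x then 1 else 0) ∂P) b := by
    refine lap_congr (fun y hy => ?_) b
    have h2 : (fun x : ℝ => if y < -x then (1:ℝ≥0∞) else 0) = (Iio (-y)).indicator 1 := by
      ext x
      simp [indicator, lt_neg]
    rw [h2, lintegral_indicator_one measurableSet_Iio, Measure.restrict_apply measurableSet_Iio,
      Iio_inter_Iio, min_eq_left (by linarith), tail]
  rw [h1, lap_lintegral (H := fun x y => if y < -x then 1 else 0)]
  · refine setLIntegral_congr_fun measurableSet_Iio fun x hx => ?_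
    have hx' : x < 0 := hx
    rw [lap_indicator_lt (by linarith) hb]
    simp
  · exact Measurable.ite (measurableSet_lt measurable_snd measurable_fst.neg) measurable_const
      measurable_const

/-- The compensated exponential, divided by b², is the transform of (a - y)⁺ with a = -x. Tonelli
then sums over the small jumps. -/
theorem lap_integratedTail (P : Measure ℝ) [SFinite P] {b : ℝ} (hb : 0 < b) :
    lap (integratedTail P) b =
      ∫⁻ x in Ioo (-1) 0, ENNReal.ofReal ((Real.exp (b * x) - 1 - b * x) / b ^ 2) ∂P := by
  have h1 : integratedTail P = fun y => ∫⁻ x in Ioo (-1) 0, ENNReal.ofReal (-x - y) ∂P := rfl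
  rw [h1, lap_lintegral (H := fun x y => ENNReal.ofReal (-x - y))]
  · refine setLIntegral_congr_fun measurableSet_Ioo fun x hx => ?_
    rw [lap_ofReal_sub (by linarith [hx.2]) hb]
    simp [sub_eq_add_neg]
  · exact ENNReal.measurable_ofReal.comp (measurable_fst.neg.sub measurable_snd)

theorem exp_sub_one_sub_nonneg (y : ℝ) : 0 ≤ Real.exp y - 1 - y := by
  linarith [Real.add_one_le_exp y]

theorem exp_sub_one_sub_le_sq {y : ℝ} (hy : y ≤ 0) : Real.exp y - 1 - y ≤ y ^ 2 := by
  rcases le_total (-1) y with h | h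
  · exact (le_abs_self _).trans (Real.abs_exp_sub_one_sub_id_le (abs_le.2 ⟨h, by linarith⟩))
  · nlinarith [Real.exp_le_one_iff.2 hy]

theorem sigmaFinite_of_lintegral_min_sq {P : Measure ℝ} (h0 : P (Ici 0) = 0)
    (h : ∫⁻ x, ENNReal.ofReal (min 1 (x ^ 2)) ∂P < ⊤) : SigmaFinite P := by
  refine ⟨⟨⟨fun n => {x | ENNReal.ofReal (1 / ((n:ℝ) + 1)) ≤ ENNReal.ofReal (min 1 (x ^ 2))} ∪
    Ici 0, fun _ => trivial, fun n => ?_, ?_⟩⟩⟩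
  · refine (measure_union_le _ _).trans_lt ?_
    rw [h0, add_zero]
    refine (meas_ge_le_lintegral_div (by fun_prop) ?_ ENNReal.ofReal_ne_top).trans_lt ?_
    · simp only [ne_eq, ENNReal.ofReal_eq_zero, not_le]
      positivity
    · refine ENNReal.div_lt_top h.ne ?_
      simp only [ne_eq, ENNReal.ofReal_eq_zero, not_le]
      positivity
  · refine eq_univ_of_forall fun x => mem_iUnion.2 ?_
    rcases le_or_gt 0 x with hx | hx
    · exact ⟨0, Or.inr hx⟩
    · obtain ⟨n, hn⟩ := exists_nat_one_div_lt (show 0 < min 1 (x ^ 2) by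
        have := sq_pos_of_neg hx
        positivity)
      exact ⟨n, Or.inl (ENNReal.ofReal_le_ofReal hn.le)⟩

theorem measure_Iio_lt_top {P : Measure ℝ} (h : ∫⁻ x, ENNReal.ofReal (min 1 (x ^ 2)) ∂P < ⊤)
    {e : ℝ} (he : 0 < e) : P (Iio (-e)) < ⊤ := by
  have hpos : 0 < min 1 (e ^ 2) := by positivity
  refine (measure_mono (t := {x | ENNReal.ofReal (min 1 (e ^ 2)) ≤ ENNReal.ofReal (min 1 (x ^ 2))})
    fun x hx => ?_).trans_lt ((meas_ge_le_lintegral_div (by fun_prop) ?_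
      ENNReal.ofReal_ne_top).trans_lt (ENNReal.div_lt_top h.ne ?_))
  · have : x < -e := hx
    exact ENNReal.ofReal_le_ofReal (min_le_min_left _ (by nlinarith))
  all_goals simpa only [ne_eq, ENNReal.ofReal_eq_zero, not_le] using hpos

/-! ### Factorisation of the Laplace exponent. -/

/-- The compensated integrand of the Laplace exponent. -/
def levyIntegrand (b x : ℝ) : ℝ :=
  Real.exp (b * x) - 1 - b * x * indicator {y : ℝ | |y| < 1} 1 x

/-- The contribution of the jumps to the Laplace exponent. -/
def jumpExponent (P : Measure ℝ) (b : ℝ) : ℝ := ∫ x in Iio 0, levyIntegrand b x ∂P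

theorem levyIntegrand_of_mem_Ioo (b : ℝ) {x : ℝ} (hx : x ∈ Ioo (-1) 0) :
    levyIntegrand b x = Real.exp (b * x) - 1 - b * x := by
  have : |x| < 1 := abs_lt.2 ⟨hx.1, by linarith [hx.2]⟩
  simp [levyIntegrand, this]

theorem levyIntegrand_of_le (b : ℝ) {x : ℝ} (hx : x ∈ Iic (-1)) :
    levyIntegrand b x = -(1 - Real.exp (b * x)) := by
  have : ¬ |x| < 1 := by
    have : x ≤ -1 := hx
    rw [abs_of_neg (by linarith)]
    linarith
  simp [levyIntegrand, this]

theorem disjoint_Iic_Ioo_neg_one : Disjoint (Iic (-1 : ℝ)) (Ioo (-1) 0) :=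
  disjoint_left.2 fun _ hx hx' => not_lt.2 hx hx'.1

theorem integrable_min_sq {P : Measure ℝ} (h : ∫⁻ x, ENNReal.ofReal (min 1 (x ^ 2)) ∂P < ⊤) :
    Integrable (fun x => min 1 (x ^ 2)) P :=
  ⟨by fun_prop, by
    rw [hasFiniteIntegral_iff_ofReal (ae_of_all _ fun x => by positivity)]
    exact h⟩

theorem integrableOn_small {P : Measure ℝ} (h : ∫⁻ x, ENNReal.ofReal (min 1 (x ^ 2)) ∂P < ⊤)
    {b : ℝ} (hb : 0 ≤ b) :
    IntegrableOn (fun x => Real.exp (b * x) - 1 - b * x) (Ioo (-1) 0) P := by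
  refine ((integrable_min_sq h).const_mul (b ^ 2)).integrableOn.mono' (by fun_prop) ?_
  filter_upwards [ae_restrict_mem measurableSet_Ioo] with x hx
  rw [Real.norm_of_nonneg (exp_sub_one_sub_nonneg _), min_eq_right (by nlinarith [hx.1, hx.2]),
    ← mul_pow]
  exact exp_sub_one_sub_le_sq (mul_nonpos_of_nonneg_of_nonpos hb hx.2.le)

theorem integrableOn_large {P : Measure ℝ} (h : ∫⁻ x, ENNReal.ofReal (min 1 (x ^ 2)) ∂P < ⊤)
    {b : ℝ} (hb : 0 ≤ b) : IntegrableOn (fun x => 1 - Real.exp (b * x)) (Iic (-1)) P := by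
  refine (integrable_min_sq h).integrableOn.mono' (by fun_prop) ?_
  filter_upwards [ae_restrict_mem measurableSet_Iic] with x hx
  have hx : x ≤ -1 := hx
  have h1 := Real.exp_le_one_iff.2 (mul_nonpos_of_nonneg_of_nonpos hb (by linarith : x ≤ 0))
  rw [Real.norm_of_nonneg (by linarith), min_eq_left (by nlinarith)]
  linarith [Real.exp_pos (b * x)]

theorem integrableOn_levyIntegrand {P : Measure ℝ}
    (h : ∫⁻ x, ENNReal.ofReal (min 1 (x ^ 2)) ∂P < ⊤) {b : ℝ} (hb : 0 ≤ b) :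
    IntegrableOn (levyIntegrand b) (Iio 0) P := by
  rw [← Iic_union_Ioo_eq_Iio (show (-1:ℝ) < 0 by norm_num)]
  exact (((integrableOn_large h hb).neg).congr_fun
    (fun x hx => (levyIntegrand_of_le b hx).symm) measurableSet_Iic).union
    ((integrableOn_small h hb).congr_fun
    (fun x hx => (levyIntegrand_of_mem_Ioo b hx).symm) measurableSet_Ioo)

theorem jumpExponent_eq {P : Measure ℝ}
    (h : ∫⁻ x, ENNReal.ofReal (min 1 (x ^ 2)) ∂P < ⊤) {b : ℝ} (hb : 0 ≤ b) :
    jumpExponent P b = ∫ x in Ioo (-1) 0, (Real.exp (b * x) - 1 - b * x) ∂P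
      - ∫ x in Iic (-1), (1 - Real.exp (b * x)) ∂P := by
  have hI := integrableOn_levyIntegrand h hb
  have hu := Iic_union_Ioo_eq_Iio (show (-1:ℝ) < 0 by norm_num)
  unfold jumpExponent
  rw [← hu] at hI ⊢
  rw [setIntegral_union disjoint_Iic_Ioo_neg_one measurableSet_Ioo
    hI.left_of_union hI.right_of_union,
    setIntegral_congr_fun measurableSet_Iic fun x hx => levyIntegrand_of_le b hx,
    setIntegral_congr_fun measurableSet_Ioo fun x hx => levyIntegrand_of_mem_Ioo b hx,
    integral_neg]
  ring

theorem lap_tail_eq_ofReal (P : Measure ℝ) [SFinite P] {b : ℝ} (hb : 0 < b)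
    (hP : IntegrableOn (fun x => 1 - Real.exp (b * x)) (Iio 0) P) :
    lap (tail P) b = ENNReal.ofReal ((∫ x in Iio 0, (1 - Real.exp (b * x)) ∂P) / b) := by
  rw [lap_tail P hb, ← integral_div, ofReal_integral_eq_lintegral_ofReal (hP.div_const b)]
  filter_upwards [ae_restrict_mem measurableSet_Iio] with x hx
  have := Real.exp_le_one_iff.2 (mul_nonpos_of_nonneg_of_nonpos hb.le (le_of_lt hx))
  exact div_nonneg (by linarith) hb.le

theorem lap_tail_large {P : Measure ℝ} [SFinite P]
    (h : ∫⁻ x, ENNReal.ofReal (min 1 (x ^ 2)) ∂P < ⊤) {b : ℝ} (hb : 0 < b) :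
    lap (tail (P.restrict (Iic (-1)))) b =
      ENNReal.ofReal ((∫ x in Iic (-1), (1 - Real.exp (b * x)) ∂P) / b) := by
  have hI := integrableOn_large h hb.le
  have hs : Iio (0:ℝ) ∩ Iic (-1) = Iic (-1) :=
    inter_eq_right.2 fun x (hx : x ≤ -1) => show x < 0 by linarith
  rw [lap_tail_eq_ofReal _ hb, Measure.restrict_restrict measurableSet_Iio, hs]
  rwa [IntegrableOn, Measure.restrict_restrict measurableSet_Iio, hs]

theorem lap_integratedTail_eq_ofReal {P : Measure ℝ} [SFinite P]
    (h : ∫⁻ x, ENNReal.ofReal (min 1 (x ^ 2)) ∂P < ⊤) {b : ℝ} (hb : 0 < b) :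
    lap (integratedTail P) b =
      ENNReal.ofReal ((∫ x in Ioo (-1) 0, (Real.exp (b * x) - 1 - b * x) ∂P) / b ^ 2) := by
  rw [lap_integratedTail P hb, ← integral_div,
    ofReal_integral_eq_lintegral_ofReal ((integrableOn_small h hb.le).div_const _)]
  exact ae_of_all _ fun x => div_nonneg (exp_sub_one_sub_nonneg _) (by positivity)

/-- The kernel `Π (-∞, -y) + q` of the renewal equation for paths of bounded variation. -/
def bvKernel (P : Measure ℝ) (q y : ℝ) : ℝ≥0∞ := tail P y + ENNReal.ofReal q

theorem measurable_bvKernel (P : Measure ℝ) (q : ℝ) : Measurable (bvKernel P q) :=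
  (measurable_tail P).add measurable_const

theorem integrableOn_id_of_bv {P : Measure ℝ}
    (h : ∫⁻ x in Ioo (-1) 0, ENNReal.ofReal |x| ∂P ≠ ⊤) : IntegrableOn (fun x => x) (Ioo (-1) 0) P :=
  ⟨by fun_prop, by
    rw [hasFiniteIntegral_iff_norm]
    exact h.lt_top⟩

theorem integrableOn_of_bv {P : Measure ℝ} (h : ∫⁻ x, ENNReal.ofReal (min 1 (x ^ 2)) ∂P < ⊤)
    (hbv : ∫⁻ x in Ioo (-1) 0, ENNReal.ofReal |x| ∂P ≠ ⊤) {b : ℝ} (hb : 0 ≤ b) :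
    IntegrableOn (fun x => 1 - Real.exp (b * x)) (Ioo (-1) 0) P := by
  refine (((integrableOn_id_of_bv hbv).const_mul b).add (integrableOn_small h hb)).neg.congr
    (ae_of_all _ fun x => ?_)
  simp only [Pi.add_apply, Pi.neg_apply]
  ring

/-- With |x| integrable near 0 the compensator can be split off and merged with -μ into the drift.
What remains is -∫(1 - e^{bx})Π(dx), which is -b times the transform of the tail. -/
theorem lap_bvKernel {P : Measure ℝ} [SFinite P]
    (h : ∫⁻ x, ENNReal.ofReal (min 1 (x ^ 2)) ∂P < ⊤)
    (hbv : ∫⁻ x in Ioo (-1) 0, ENNReal.ofReal |x| ∂P ≠ ⊤) (mu : ℝ) {q b : ℝ} (hq : 0 ≤ q)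
    (hb : 0 < b) : lap (bvKernel P q) b ≠ ⊤ ∧
      -mu * b + jumpExponent P b - q =
        b * ((-mu - ∫ x in Ioo (-1) 0, x ∂P) - (lap (bvKernel P q) b).toReal) := by
  have hu := Iic_union_Ioo_eq_Iio (show (-1:ℝ) < 0 by norm_num)
  have h1 := integrableOn_large h hb.le
  have h2 := integrableOn_of_bv h hbv hb.le
  have h3 := h1.union h2
  rw [hu] at h3
  have hlap : lap (bvKernel P q) b = ENNReal.ofReal
      ((∫ x in Iio 0, (1 - Real.exp (b * x)) ∂P) / b) + ENNReal.ofReal (q * (1 / b)) := by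
    rw [ENNReal.ofReal_mul hq, ← lap_const hb, ← lap_tail_eq_ofReal P hb h3]
    exact lap_add (measurable_tail P) _ b
  have hpos : 0 ≤ ∫ x in Iio 0, (1 - Real.exp (b * x)) ∂P := by
    refine setIntegral_nonneg measurableSet_Iio fun x hx => ?_
    have := Real.exp_le_one_iff.2 (mul_nonpos_of_nonneg_of_nonpos hb.le (le_of_lt hx))
    linarith
  refine ⟨by rw [hlap]; simp, ?_⟩
  rw [hlap, ENNReal.toReal_add (by simp) (by simp), ENNReal.toReal_ofReal (by positivity),
    ENNReal.toReal_ofReal (by positivity), jumpExponent_eq h hb.le]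
  have hsmall : ∫ x in Ioo (-1) 0, (Real.exp (b * x) - 1 - b * x) ∂P =
      -(∫ x in Ioo (-1) 0, (1 - Real.exp (b * x)) ∂P) - b * ∫ x in Ioo (-1) 0, x ∂P := by
    rw [← integral_const_mul, ← integral_neg]
    refine Eq.trans (integral_congr_ae (ae_of_all _ fun x => ?_))
      (integral_sub h2.neg ((integrableOn_id_of_bv hbv).const_mul b))
    simp only
    ring
  rw [hsmall, ← hu, setIntegral_union disjoint_Iic_Ioo_neg_one measurableSet_Ioo h1 h2]
  field_simp
  ring

/-- The kernel on the left hand side of the renewal equation in the general case. -/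
def kernelLeft (P : Measure ℝ) (mu y : ℝ) : ℝ≥0∞ := integratedTail P y + ENNReal.ofReal (-mu)

/-- The kernel on the right hand side of the renewal equation in the general case. -/
def kernelRight (P : Measure ℝ) (mu q y : ℝ) : ℝ≥0∞ :=
  ENNReal.ofReal mu + (lconv (fun _ => 1) (tail (P.restrict (Iic (-1)))) y +
    ENNReal.ofReal q * ENNReal.ofReal y)

theorem measurable_kernelLeft (P : Measure ℝ) (mu : ℝ) : Measurable (kernelLeft P mu) :=
  (measurable_integratedTail P).add measurable_const

theorem measurable_kernelRight (P : Measure ℝ) (mu q : ℝ) : Measurable (kernelRight P mu q) :=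
  measurable_const.add ((measurable_lconv measurable_const (measurable_tail _)).add
    (ENNReal.measurable_ofReal.const_mul _))

/-- Small jumps need second order compensation, so their tail is integrated twice and enters with a
plus sign. Large jumps and q enter with a minus sign and go to the other kernel; μ goes to one side
or the other according to its sign, which keeps both kernels nonnegative. -/
theorem lap_kernels {P : Measure ℝ} [SFinite P]
    (h : ∫⁻ x, ENNReal.ofReal (min 1 (x ^ 2)) ∂P < ⊤) (d mu : ℝ) {q b : ℝ} (hq : 0 ≤ q)
    (hb : 0 < b) : lap (kernelLeft P mu) b ≠ ⊤ ∧ lap (kernelRight P mu q) b ≠ ⊤ ∧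
      -mu * b + d * b ^ 2 + jumpExponent P b - q =
        b ^ 2 * (d + (lap (kernelLeft P mu) b).toReal - (lap (kernelRight P mu q) b).toReal) := by
  set J := ∫ x in Ioo (-1) 0, (Real.exp (b * x) - 1 - b * x) ∂P with hJ
  set T := ∫ x in Iic (-1), (1 - Real.exp (b * x)) ∂P with hT
  have hJ0 : 0 ≤ J := integral_nonneg fun x => exp_sub_one_sub_nonneg _
  have hT0 : 0 ≤ T := by
    refine setIntegral_nonneg measurableSet_Iic fun x hx => ?_
    have hx : x ≤ -1 := hx
    have := Real.exp_le_one_iff.2 (mul_nonpos_of_nonneg_of_nonpos hb.le (by linarith : x ≤ 0))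
    linarith
  have hL : lap (kernelLeft P mu) b =
      ENNReal.ofReal (J / b ^ 2) + ENNReal.ofReal (-mu) * ENNReal.ofReal (1 / b) := by
    rw [← lap_const hb, ← lap_integratedTail_eq_ofReal h hb]
    exact lap_add (measurable_integratedTail P) _ b
  have hR : lap (kernelRight P mu q) b = ENNReal.ofReal mu * ENNReal.ofReal (1 / b) +
      (ENNReal.ofReal (1 / b) * ENNReal.ofReal (T / b) +
        ENNReal.ofReal q * ENNReal.ofReal (1 / b ^ 2)) := by
    rw [← lap_const hb, ← lap_ofReal hb, ← lap_tail_large h hb,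
      ← lap_const_mul ENNReal.measurable_ofReal, ← lap_one hb,
      ← lap_lconv measurable_const (measurable_tail _),
      ← lap_add (measurable_lconv measurable_const (measurable_tail _))]
    exact lap_add measurable_const _ b
  refine ⟨by rw [hL]; finiteness, by rw [hR]; finiteness, ?_⟩
  rw [hL, hR, ENNReal.toReal_add (by finiteness) (by finiteness),
    ENNReal.toReal_add (by finiteness) (by finiteness),
    ENNReal.toReal_add (by finiteness) (by finiteness)]
  simp only [ENNReal.toReal_mul, ENNReal.toReal_ofReal']
  rw [max_eq_left (by positivity : 0 ≤ J / b ^ 2), max_eq_left (by positivity : 0 ≤ 1 / b),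
    max_eq_left (by positivity : 0 ≤ T / b), max_eq_left hq,
    max_eq_left (by positivity : 0 ≤ 1 / b ^ 2), jumpExponent_eq h hb.le, ← hJ, ← hT]
  have hmu : max (-mu) 0 - max mu 0 = -mu := by
    rcases le_total mu 0 with hm | hm
    · rw [max_eq_left (by linarith), max_eq_right hm]; ring
    · rw [max_eq_right (by linarith), max_eq_left hm]; ring
  have hmub : -mu * b = (max (-mu) 0 - max mu 0) * b := by rw [hmu]
  rw [hmub]
  field_simp
  ring

/-! ### Monotonicity under limits of Laplace transforms. -/

/-- The values at `b, b + 1, b + 2, …` of the Laplace transforms of nondecreasing functions. -/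
def monotoneTransforms (b : ℝ) : Set (ℕ → ℝ≥0∞) :=
  {G | ∃ w : ℝ → ℝ≥0∞, Measurable w ∧ Monotone w ∧ lap w b ≠ ⊤ ∧ G = fun j : ℕ => lap w (b + j)}

/-- This expresses monotonicity through integrals against test functions, a form that passes to weak
limits. -/
theorem lintegral_le_shift_of_monotone {w : ℝ → ℝ≥0∞} (hw : Monotone w) {F : ℝ → ℝ}
    (hF0 : ∀ x, x ≤ 0 → F x = 0) {h : ℝ} (hh : 0 ≤ h) :
    ∫⁻ x in Ioi 0, w x * ENNReal.ofReal (F x) ≤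
      ∫⁻ x in Ioi 0, w x * ENNReal.ofReal (F (x - h)) := by
  have key : ∀ a, 0 ≤ a → ∫⁻ x in Ioi 0, w x * ENNReal.ofReal (F (x - a)) =
      ∫⁻ x, w (x + a) * ENNReal.ofReal (F x) := by
    intro a ha
    rw [← lintegral_sub_right_eq_self (fun x => w (x + a) * ENNReal.ofReal (F x)) a,
      ← lintegral_indicator measurableSet_Ioi]
    congr 1
    ext x
    by_cases hx : 0 < x
    · simp [hx]
    · simp [hx, hF0 (x - a) (by linarith)]
  have h0 := key 0 le_rfl
  simp only [sub_zero, add_zero] at h0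
  rw [h0, key h hh]
  refine lintegral_mono fun x => ?_
  have := hw (show x ≤ x + h by linarith)
  gcongr

theorem lintegral_le_shift_of_mem_closure {f : ℝ → ℝ≥0∞} (hf : Measurable f) {b : ℝ}
    (hb : lap f b ≠ ⊤) (hmem : (fun j : ℕ => lap f (b + j)) ∈ closure (monotoneTransforms b))
    {F : ℝ → ℝ} (hF : Continuous F) (hFn : ∀ x, 0 ≤ F x) (hF0 : ∀ x, x ≤ 0 → F x = 0) {R : ℝ}
    (hFR : ∀ x, R ≤ x → F x = 0) {h : ℝ} (hh : 0 ≤ h) :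
    ∫⁻ x in Ioi 0, f x * ENNReal.ofReal (F x) ≤
      ∫⁻ x in Ioi 0, f x * ENNReal.ofReal (F (x - h)) := by
  obtain ⟨G, hG, hlim⟩ := mem_closure_iff_seq_limit.1 hmem
  choose w hwm hw hwb hGw using hG
  have hlim' : ∀ j : ℕ, Tendsto (fun n => lap (w n) (b + j)) atTop (𝓝 (lap f (b + j))) := by
    intro j
    have := tendsto_pi_nhds.1 hlim j
    simpa only [hGw] using this
  have h1 := tendsto_lintegral_of_tendsto_lap hwm hf hwb hb hlim' hF hFn hFR
  have h2 := tendsto_lintegral_of_tendsto_lap (F := fun x => F (x - h)) hwm hf hwb hb hlim'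
    (by fun_prop) (fun x => hFn _) (R := R + h) (fun x hx => hFR _ (by linarith))
  exact le_of_tendsto_of_tendsto' h1 h2 fun n => lintegral_le_shift_of_monotone (hw n) hF0 hh

/-- If W dropped from x to y, right continuity would keep W above c' just after x and below c < c'
just after y. Moving a bump from the first interval to the second would then decrease its integral
against W. -/
theorem monotoneOn_of_mem_closure {W : ℝ → ℝ} (hWm : Measurable W)
    (hWc : ∀ x, 0 ≤ x → ContinuousWithinAt W (Ici x) x) {b : ℝ}
    (hb : lap (fun x => ENNReal.ofReal (W x)) b ≠ ⊤) (hW0 : ∀ x, 0 ≤ W x)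
    (hmem : (fun j : ℕ => lap (fun x => ENNReal.ofReal (W x)) (b + j)) ∈
      closure (monotoneTransforms b)) : MonotoneOn W (Ici 0) := by
  intro x hx y _ hxy
  have hx : 0 ≤ x := hx
  by_contra! hlt
  obtain ⟨c, hc1, hc2⟩ := exists_between hlt
  obtain ⟨c', hc1', hc2'⟩ := exists_between hc2
  have e1 := (hWc x hx).eventually_const_lt hc2'
  have e2 := (hWc y (hx.trans hxy)).eventually_lt_const hc1
  obtain ⟨u, hu, hu'⟩ := mem_nhdsGE_iff_exists_Ico_subset.1 e1
  obtain ⟨v, hv, hv'⟩ := mem_nhdsGE_iff_exists_Ico_subset.1 e2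
  have hu : x < u := hu
  have hv : y < v := hv
  set r := min (u - x) (v - y)
  have hr : 0 < r := lt_min (by linarith) (by linarith)
  have hru : r ≤ u - x := min_le_left _ _
  have hrv : r ≤ v - y := min_le_right _ _
  set F : ℝ → ℝ := fun z => max 0 (min (z - x) (x + r - z))
  have hF : Continuous F := by fun_prop
  have hFn : ∀ z, 0 ≤ F z := fun z => le_max_left _ _
  have hFl : ∀ z, z ≤ x → F z = 0 := fun z hz =>
    max_eq_left ((min_le_left _ _).trans (by linarith))
  have hFr : ∀ z, x + r ≤ z → F z = 0 := fun z hz =>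
    max_eq_left ((min_le_right _ _).trans (by linarith))
  have hFle : ∀ z, F z ≤ r := by
    intro z
    rcases le_total z x with hz | hz
    · rw [hFl z hz]; exact hr.le
    · exact max_le hr.le ((min_le_right _ _).trans (by linarith))
  have main := lintegral_le_shift_of_mem_closure (by fun_prop) hb hmem hF hFn
    (fun z hz => hFl z (hz.trans hx)) hFr (h := y - x) (by linarith)
  set I := ∫⁻ z, ENNReal.ofReal (F z) with hI
  have hIpos : I ≠ 0 := by
    rw [hI, Ne, lintegral_eq_zero_iff (by fun_prop)]
    intro h0
    have h1 : (Ioo x (x + r)) ⊆ {z | ¬ (fun z => ENNReal.ofReal (F z)) z = (0 : ℝ → ℝ≥0∞) z} := by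
      intro z hz
      have : 0 < F z := lt_max_of_lt_right (lt_min (by linarith [hz.1]) (by linarith [hz.2]))
      simpa using this
    have h2 := measure_mono_null h1 h0
    rw [Real.volume_Ioo, ENNReal.ofReal_eq_zero] at h2
    linarith
  have hItop : I ≠ ⊤ := by
    have : I ≤ ∫⁻ z in Icc x (x + r), ENNReal.ofReal r := by
      rw [hI, ← lintegral_indicator measurableSet_Icc]
      refine lintegral_mono fun z => ?_
      by_cases hz : z ∈ Icc x (x + r)
      · simpa [indicator_of_mem hz] using ENNReal.ofReal_le_ofReal (hFle z)
      · rw [indicator_of_notMem hz]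
        rcases not_and_or.1 hz with hz | hz
        · simp [hFl z (by linarith)]
        · simp [hFr z (by linarith)]
    refine ne_top_of_le_ne_top ?_ this
    simp [ENNReal.mul_eq_top]
  have lower : ENNReal.ofReal c' * I ≤ ∫⁻ z in Ioi 0, ENNReal.ofReal (W z) *
      ENNReal.ofReal (F z) := by
    rw [hI, ← lintegral_const_mul _ (by fun_prop), ← lintegral_indicator measurableSet_Ioi]
    refine lintegral_mono fun z => ?_
    by_cases hz : z ∈ Ioo x (x + r)
    · rw [indicator_of_mem (show z ∈ Ioi (0:ℝ) from hx.trans_lt hz.1)]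
      have : c' < W z := hu' ⟨hz.1.le, by linarith [hz.2]⟩
      have := ENNReal.ofReal_le_ofReal this.le
      gcongr
    · rcases not_and_or.1 hz with hz | hz
      · simp [hFl z (by linarith)]
      · simp [hFr z (by linarith)]
  have upper : ∫⁻ z in Ioi 0, ENNReal.ofReal (W z) * ENNReal.ofReal (F (z - (y - x))) ≤
      ENNReal.ofReal c * I := by
    rw [hI, ← lintegral_sub_right_eq_self (fun z => ENNReal.ofReal (F z)) (y - x),
      ← lintegral_const_mul _ (by fun_prop), ← lintegral_indicator measurableSet_Ioi]
    refine lintegral_mono fun z => ?_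
    by_cases hz : z - (y - x) ∈ Ioo x (x + r)
    · refine (indicator_le_self _ _ _).trans ?_
      have : W z < c := hv' ⟨by linarith [hz.1], by linarith [hz.2]⟩
      have := ENNReal.ofReal_le_ofReal this.le
      gcongr
    · have : F (z - (y - x)) = 0 := by
        rcases not_and_or.1 hz with hz | hz
        · exact hFl _ (by linarith)
        · exact hFr _ (by linarith)
      simp [this, indicator]
  have := (lower.trans main).trans upper
  -- Cancelling the mass of the bump leaves c' ≤ c, contrary to the choice of levels.
  rw [ENNReal.mul_le_mul_iff_left hIpos hItop,
    ENNReal.ofReal_le_ofReal_iff ((hW0 y).trans hc1.le)] at this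
  linarith

/-! ### Neumann series of the renewal equation. -/

/-- The partial sums of the Neumann series of the renewal equation `w = c + c k * w`. -/
def renewalIterate (c : ℝ≥0∞) (k : ℝ → ℝ≥0∞) : ℕ → ℝ → ℝ≥0∞
  | 0 => fun _ => c
  | n + 1 => fun x => c + c * lconv k (renewalIterate c k n) x

theorem measurable_renewalIterate (c : ℝ≥0∞) {k : ℝ → ℝ≥0∞} (hk : Measurable k) (n : ℕ) :
    Measurable (renewalIterate c k n) := by
  induction n with
  | zero => exact measurable_const
  | succ n ih => exact measurable_const.add ((measurable_lconv hk ih).const_mul c)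

theorem monotone_renewalIterate (c : ℝ≥0∞) (k : ℝ → ℝ≥0∞) (n : ℕ) :
    Monotone (renewalIterate c k n) := by
  induction n with
  | zero => exact monotone_const
  | succ n ih =>
    intro x y hxy
    have := lconv_monotone k ih hxy
    simp only [renewalIterate]
    gcongr

theorem lap_renewalIterate (c : ℝ≥0∞) {k : ℝ → ℝ≥0∞} (hk : Measurable k) {b : ℝ} (hb : 0 < b)
    (n : ℕ) : lap (renewalIterate c k n) b =
      c * ENNReal.ofReal (1 / b) * ∑ i ∈ Finset.range (n + 1), (c * lap k b) ^ i := by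
  induction n with
  | zero => simpa [renewalIterate] using lap_const hb c
  | succ n ih =>
    have hm := measurable_renewalIterate c hk n
    have h1 : lap (renewalIterate c k (n + 1)) b =
        lap (fun _ => c) b + lap (fun x => c * lconv k (renewalIterate c k n) x) b :=
      lap_add measurable_const _ b
    rw [h1, lap_const hb, lap_const_mul (measurable_lconv hk hm), lap_lconv hk hm, ih,
      Finset.sum_range_succ' _ (n + 1)]
    simp only [pow_succ, ← Finset.sum_mul, pow_zero]
    ring

/-- The transforms of the partial sums are geometric sums. Working with the closure in the space of
sequences avoids constructing the limit function. -/
theorem renewal_mem_closure {c : ℝ≥0∞} (hc : c ≠ ⊤) {k : ℝ → ℝ≥0∞} (hk : Measurable k) {b : ℝ}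
    (hb : 0 < b) (hkb : lap k b ≠ ⊤) :
    (fun j : ℕ => c * ENNReal.ofReal (1 / (b + j)) * (1 - c * lap k (b + j))⁻¹) ∈
      closure (monotoneTransforms b) := by
  refine mem_closure_of_tendsto (f := fun n (j : ℕ) => lap (renewalIterate c k n) (b + j))
    (b := atTop) ?_ (Eventually.of_forall fun n =>
      ⟨_, measurable_renewalIterate c hk n, monotone_renewalIterate c k n, ?_, rfl⟩)
  · refine tendsto_pi_nhds.2 fun j => ?_
    simp_rw [lap_renewalIterate c hk (show 0 < b + j by positivity)]
    refine ENNReal.Tendsto.const_mul ?_ (Or.inr (by finiteness))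
    rw [← ENNReal.tsum_geometric]
    exact ENNReal.summable.hasSum.tendsto_sum_nat.comp (tendsto_add_atTop_nat 1)
  · rw [lap_renewalIterate c hk hb]
    refine ENNReal.mul_ne_top (by finiteness) (ENNReal.sum_ne_top.2 fun i _ => by finiteness)

/-- Absorbing a convergent geometric factor: the Laplace transform of the renewal function. -/
theorem ofReal_renewal {b δ : ℝ} (hb : 0 < b) (hδ : 0 < δ) {κ : ℝ≥0∞} (hκ : κ ≠ ⊤)
    (hlt : κ.toReal < δ) :
    ENNReal.ofReal (1 / δ) * ENNReal.ofReal (1 / b) * (1 - ENNReal.ofReal (1 / δ) * κ)⁻¹ =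
      ENNReal.ofReal (1 / (b * (δ - κ.toReal))) := by
  lift κ to NNReal using hκ
  have hlt' : (κ : ℝ) < δ := hlt
  rw [← ENNReal.ofReal_coe_nnreal, ← ENNReal.ofReal_mul (p := 1 / δ) (q := κ) (by positivity),
    ← ENNReal.ofReal_one, ← ENNReal.ofReal_sub _ (by positivity), ← ENNReal.ofReal_inv_of_pos,
    ← ENNReal.ofReal_mul (by positivity), ← ENNReal.ofReal_mul (by positivity),
    ENNReal.toReal_ofReal κ.coe_nonneg]
  · congr 1
    have : δ - κ ≠ 0 := by linarith
    field_simp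
  · rw [sub_pos, one_div, inv_mul_lt_iff₀ hδ]
    linarith

/-- By the factorisation, ψ > q at b + j says exactly that the kernel's transform there is below the
drift. The geometric series therefore converges, to the transform 1/(ψ - q). -/
theorem bv_mem_closure {P : Measure ℝ} [SFinite P]
    (h : ∫⁻ x, ENNReal.ofReal (min 1 (x ^ 2)) ∂P < ⊤)
    (hbv : ∫⁻ x in Ioo (-1) 0, ENNReal.ofReal |x| ∂P ≠ ⊤) (mu : ℝ) {q b : ℝ} (hq : 0 ≤ q)
    (hb : 0 < b) (hpos : ∀ j : ℕ, q < -mu * (b + j) + jumpExponent P (b + j)) :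
    (fun j : ℕ => ENNReal.ofReal (1 / (-mu * (b + j) + jumpExponent P (b + j) - q))) ∈
      closure (monotoneTransforms b) := by
  set δ := -mu - ∫ x in Ioo (-1) 0, x ∂P with hδ
  have hbj : ∀ j : ℕ, 0 < b + j := fun j => by positivity
  have key := fun j => lap_bvKernel h hbv mu hq (hbj j)
  have hlt : ∀ j : ℕ, (lap (bvKernel P q) (b + j)).toReal < δ := by
    intro j
    have h1 := (key j).2
    have h2 := pos_of_mul_pos_right (a := b + j) (h1 ▸ sub_pos.2 (hpos j)) (hbj j).le
    linarith
  have hδ0 : 0 < δ := lt_of_le_of_lt ENNReal.toReal_nonneg (hlt 0)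
  have := renewal_mem_closure (c := ENNReal.ofReal (1 / δ)) ENNReal.ofReal_ne_top
    (measurable_bvKernel P q) hb (lap_bvKernel h hbv mu hq hb).1
  convert this using 2 with j
  rw [ofReal_renewal (hbj j) hδ0 (key j).1 (hlt j), (key j).2]

/-! ### Approximation by truncating the small jumps. -/

/-- The Lévy measure without the jumps of size at most `1 / (n + 2)`. -/
def truncation (P : Measure ℝ) (n : ℕ) : Measure ℝ := P.restrict (Iio (-(1 / ((n : ℝ) + 2))))

/-- The `2` keeps the cut strictly inside (-1,0), so only jumps with a compensated, hence
nonnegative, integrand are removed. -/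
theorem truncation_level_mem (n : ℕ) : -(1 / ((n : ℝ) + 2)) ∈ Ioo (-1 : ℝ) 0 := by
  have h : 0 < 1 / ((n : ℝ) + 2) := by positivity
  have h' : 1 / ((n : ℝ) + 2) < 1 := by
    rw [div_lt_one (by positivity)]
    linarith [n.cast_nonneg (α := ℝ)]
  exact ⟨by linarith, by linarith⟩

theorem monotone_truncation_level : Monotone fun n : ℕ => -(1 / ((n : ℝ) + 2)) := by
  intro n m hnm
  have : (n : ℝ) ≤ m := Nat.cast_le.2 hnm
  simp only [neg_le_neg_iff]
  gcongr

theorem iUnion_Iio_truncation_level : ⋃ n : ℕ, Iio (-(1 / ((n : ℝ) + 2))) = Iio 0 := by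
  ext x
  simp only [mem_iUnion, mem_Iio]
  constructor
  · rintro ⟨n, hn⟩
    linarith [(truncation_level_mem n).2]
  · intro hx
    obtain ⟨n, hn⟩ := exists_nat_one_div_lt (show 0 < -x by linarith)
    refine ⟨n, ?_⟩
    have : 1 / ((n : ℝ) + 2) ≤ 1 / ((n : ℝ) + 1) := by gcongr; norm_num
    linarith

theorem lintegral_truncation_lt_top {P : Measure ℝ}
    (h : ∫⁻ x, ENNReal.ofReal (min 1 (x ^ 2)) ∂P < ⊤) (n : ℕ) :
    ∫⁻ x, ENNReal.ofReal (min 1 (x ^ 2)) ∂(truncation P n) < ⊤ :=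
  (lintegral_mono' Measure.restrict_le_self le_rfl).trans_lt h

theorem lintegral_abs_ne_top {P : Measure ℝ} (h : P (Iio 0) < ⊤) :
    ∫⁻ x in Ioo (-1) 0, ENNReal.ofReal |x| ∂P ≠ ⊤ := by
  have h1 : ∫⁻ x in Ioo (-1) 0, ENNReal.ofReal |x| ∂P ≤ ∫⁻ x in Ioo (-1) 0, 1 ∂P := by
    refine setLIntegral_mono' measurableSet_Ioo fun x hx => ?_
    rw [ENNReal.ofReal_le_one, abs_le]
    exact ⟨hx.1.le, by linarith [hx.2]⟩
  refine ne_top_of_le_ne_top ?_ h1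
  rw [setLIntegral_one]
  exact ((measure_mono Ioo_subset_Iio_self).trans_lt h).ne

theorem truncation_Iio_lt_top {P : Measure ℝ}
    (h : ∫⁻ x, ENNReal.ofReal (min 1 (x ^ 2)) ∂P < ⊤) (n : ℕ) : truncation P n (Iio 0) < ⊤ := by
  refine (measure_mono (subset_univ _)).trans_lt ?_
  rw [truncation, Measure.restrict_apply_univ]
  exact measure_Iio_lt_top h (by positivity)

theorem jumpExponent_truncation (P : Measure ℝ) (n : ℕ) (b : ℝ) :
    jumpExponent (truncation P n) b =
      ∫ x in Iio (-(1 / ((n : ℝ) + 2))), levyIntegrand b x ∂P := by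
  rw [jumpExponent, truncation, Measure.restrict_restrict measurableSet_Iio, Iio_inter_Iio,
    min_eq_right (truncation_level_mem n).2.le]

theorem tendsto_jumpExponent_truncation {P : Measure ℝ}
    (h : ∫⁻ x, ENNReal.ofReal (min 1 (x ^ 2)) ∂P < ⊤) {b : ℝ} (hb : 0 ≤ b) :
    Tendsto (fun n => jumpExponent (truncation P n) b) atTop (𝓝 (jumpExponent P b)) := by
  simp_rw [jumpExponent_truncation]
  rw [jumpExponent, ← iUnion_Iio_truncation_level]
  refine tendsto_setIntegral_of_monotone (fun _ => measurableSet_Iio)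
    (fun n m hnm => Iio_subset_Iio (monotone_truncation_level hnm)) ?_
  rw [iUnion_Iio_truncation_level]
  exact integrableOn_levyIntegrand h hb

/-- Lowering the cut only adds jumps in (-1,0), where e^{bx} - 1 - bx ≥ 0. -/
theorem monotone_jumpExponent_truncation {P : Measure ℝ}
    (h : ∫⁻ x, ENNReal.ofReal (min 1 (x ^ 2)) ∂P < ⊤) {b : ℝ} (hb : 0 ≤ b) :
    Monotone fun n => jumpExponent (truncation P n) b := by
  intro n m hnm
  have hle := monotone_truncation_level hnm
  have hn := truncation_level_mem n
  have hm := truncation_level_mem m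
  simp only [jumpExponent_truncation] at hle ⊢
  have hI := (integrableOn_levyIntegrand h hb).mono_set (Iio_subset_Iio hm.2.le)
  rw [← Iio_union_Ico_eq_Iio hle] at hI ⊢
  rw [setIntegral_union (disjoint_left.2 fun x hx hx' => not_lt.2 (mem_Ico.1 hx').1 (mem_Iio.1 hx))
    measurableSet_Ico
    hI.left_of_union hI.right_of_union]
  refine le_add_of_nonneg_right (setIntegral_nonneg measurableSet_Ico fun x hx => ?_)
  rw [levyIntegrand_of_mem_Ioo b ⟨by linarith [hx.1, hn.1], by linarith [hx.2, hm.2]⟩]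
  exact exp_sub_one_sub_nonneg _

/-- The truncated drift is -μ plus the integral of |x| over the small jumps kept, and that integral
diverges by unbounded variation. -/
theorem exists_lt_drift_truncation {P : Measure ℝ}
    (h : ∫⁻ x, ENNReal.ofReal (min 1 (x ^ 2)) ∂P < ⊤)
    (huv : ∫⁻ x in Ioo (-1) 0, ENNReal.ofReal |x| ∂P = ⊤) (mu : ℝ) :
    ∃ n, 0 < -mu - ∫ x in Ioo (-1) 0, x ∂(truncation P n) := by
  have hlim : Tendsto (fun n => ∫⁻ x in Ioo (-1) 0, ENNReal.ofReal |x| ∂(truncation P n)) atTop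
      (𝓝 ⊤) := by
    have hmono : Monotone fun n : ℕ => Ioo (-1:ℝ) 0 ∩ Iio (-(1 / ((n : ℝ) + 2))) :=
      fun n m hnm => inter_subset_inter_right _ (Iio_subset_Iio (monotone_truncation_level hnm))
    have hU : ⋃ n : ℕ, Ioo (-1:ℝ) 0 ∩ Iio (-(1 / ((n : ℝ) + 2))) = Ioo (-1) 0 := by
      rw [← inter_iUnion, iUnion_Iio_truncation_level, inter_eq_left]
      exact Ioo_subset_Iio_self
    have htr : ∀ n, (truncation P n).restrict (Ioo (-1) 0) =
        P.restrict (Ioo (-1) 0 ∩ Iio (-(1 / ((n : ℝ) + 2)))) :=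
      fun n => Measure.restrict_restrict measurableSet_Ioo
    simp_rw [htr]
    have hsup := setLIntegral_iUnion_of_directed (μ := P) (fun x => ENNReal.ofReal |x|)
      hmono.directed_le
    rw [hU, huv] at hsup
    rw [hsup]
    exact tendsto_atTop_iSup fun n m hnm => lintegral_mono_set (hmono hnm)
  obtain ⟨n, hn⟩ := (hlim.eventually_const_lt (u := ENNReal.ofReal mu) (by simp)).exists
  refine ⟨n, ?_⟩
  have hI := integrableOn_id_of_bv (lintegral_abs_ne_top (truncation_Iio_lt_top h n))
  rw [← ofReal_integral_eq_lintegral_ofReal hI.abs (ae_of_all _ fun x => abs_nonneg x),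
    setIntegral_congr_fun measurableSet_Ioo fun x hx => abs_of_neg hx.2, integral_neg,
    ENNReal.ofReal_lt_ofReal_iff'] at hn
  linarith [hn.1]

theorem eventually_lt_of_bv {P : Measure ℝ} [SFinite P]
    (h : ∫⁻ x, ENNReal.ofReal (min 1 (x ^ 2)) ∂P < ⊤)
    (hbv : ∫⁻ x in Ioo (-1) 0, ENNReal.ofReal |x| ∂P ≠ ⊤) {mu q : ℝ} (hq : 0 ≤ q)
    (hδ : 0 < -mu - ∫ x in Ioo (-1) 0, x ∂P) :
    ∀ᶠ b in atTop, q < -mu * b + jumpExponent P b := by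
  have h1 := (ENNReal.tendsto_toReal ENNReal.zero_ne_top).comp (tendsto_lap_zero
    (measurable_bvKernel P q) (lap_bvKernel h hbv mu hq one_pos).1)
  filter_upwards [h1.eventually_lt_const hδ, eventually_gt_atTop 0] with b hb hb0
  have := mul_pos hb0 (sub_pos.2 hb)
  simp only [Function.comp_apply] at this
  rw [← (lap_bvKernel h hbv mu hq hb0).2] at this
  linarith

/-- The transforms for the truncated measures lie in the closure and converge pointwise, and a
closed set retains its limits. -/
theorem uv_mem_closure {P : Measure ℝ} [SFinite P]
    (h : ∫⁻ x, ENNReal.ofReal (min 1 (x ^ 2)) ∂P < ⊤)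
    (huv : ∫⁻ x in Ioo (-1) 0, ENNReal.ofReal |x| ∂P = ⊤) (mu : ℝ) {q : ℝ} (hq : 0 ≤ q) :
    ∃ b₀ > 0, ∀ b ≥ b₀, q < -mu * b + jumpExponent P b ∧
      (fun j : ℕ => ENNReal.ofReal (1 / (-mu * (b + j) + jumpExponent P (b + j) - q))) ∈
        closure (monotoneTransforms b) := by
  obtain ⟨N, hN⟩ := exists_lt_drift_truncation h huv mu
  have hs : ∀ n, SFinite (truncation P n) := fun n => by unfold truncation; infer_instance
  have ht := lintegral_truncation_lt_top h
  have hbv := fun n => lintegral_abs_ne_top (truncation_Iio_lt_top h n)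
  -- The threshold is found for the single truncation `N`. Since exponents increase with n, it
  -- serves every n ≥ N and the limit.
  obtain ⟨b₁, hb₁⟩ := eventually_atTop.1 (eventually_lt_of_bv (ht N) (hbv N) hq hN)
  refine ⟨max b₁ 1, lt_max_of_lt_right one_pos, fun b hb => ?_⟩
  have hb0 : 0 < b := one_pos.trans_le ((le_max_right _ _).trans hb)
  have hbn : ∀ c ≥ b, ∀ n ≥ N, q < -mu * c + jumpExponent (truncation P n) c := by
    intro c hc n hn
    have h1 := hb₁ c ((le_max_left _ _).trans (hb.le.trans hc))
    have h2 := monotone_jumpExponent_truncation h (hb0.le.trans hc) hn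
    simp only at h2
    linarith
  have hlim : ∀ c ≥ b, Tendsto (fun n => -mu * c + jumpExponent (truncation P n) c) atTop
      (𝓝 (-mu * c + jumpExponent P c)) := fun c hc =>
    (tendsto_jumpExponent_truncation h (hb0.le.trans hc)).const_add _
  have hlt : ∀ c ≥ b, q < -mu * c + jumpExponent P c := by
    intro c hc
    have hle := (monotone_jumpExponent_truncation h (hb0.le.trans hc)).ge_of_tendsto
      (tendsto_jumpExponent_truncation h (hb0.le.trans hc)) N
    have := hbn c hc N le_rfl
    linarith
  have hbj : ∀ j : ℕ, b ≤ b + j := fun j => by simp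
  refine ⟨hlt b le_rfl, ?_⟩
  refine isClosed_closure.mem_of_tendsto (b := atTop) (f := fun n (j : ℕ) =>
    ENNReal.ofReal (1 / (-mu * (b + j) + jumpExponent (truncation P n) (b + j) - q))) ?_ ?_
  · refine tendsto_pi_nhds.2 fun j => ENNReal.tendsto_ofReal ?_
    exact tendsto_const_nhds.div ((hlim _ (hbj j)).sub_const q)
      (sub_pos.2 (hlt _ (hbj j))).ne'
  · filter_upwards [eventually_ge_atTop N] with n hn
    exact bv_mem_closure (ht n) (hbv n) mu hq hb0 fun j => hbn _ (hbj j) n hn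

/-! ### Right continuity: measurability, and passing from almost everywhere to everywhere. -/

theorem measurable_of_rightContinuous {W : ℝ → ℝ}
    (hW : ∀ x, ContinuousWithinAt W (Ici x) x) : Measurable W := by
  -- W is sampled at the next grid point strictly to the right of x. This depends on x only through
  -- an integer and converges to x from the right.
  refine measurable_of_tendsto_metrizable
    (f := fun (n : ℕ) x => W ((⌊((n : ℝ) + 1) * x⌋ + 1 : ℤ) / ((n : ℝ) + 1))) (fun n => ?_) ?_
  · exact (measurable_from_top (f := fun m : ℤ => W ((m + 1 : ℤ) / ((n : ℝ) + 1)))).comp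
      (Int.measurable_floor.comp (measurable_const.mul measurable_id))
  · refine tendsto_pi_nhds.2 fun x => ?_
    have hge : ∀ n : ℕ, x ≤ (⌊((n : ℝ) + 1) * x⌋ + 1 : ℤ) / ((n : ℝ) + 1) := by
      intro n
      rw [le_div_iff₀ (by positivity)]
      push_cast
      linarith [Int.lt_floor_add_one (((n : ℝ) + 1) * x)]
    refine (hW x).tendsto.comp (tendsto_nhdsWithin_iff.2 ⟨?_, Eventually.of_forall hge⟩)
    have hle : ∀ n : ℕ, (⌊((n : ℝ) + 1) * x⌋ + 1 : ℤ) / ((n : ℝ) + 1) ≤ x + 1 / ((n : ℝ) + 1) := by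
      intro n
      rw [div_le_iff₀ (by positivity)]
      push_cast
      have := Int.floor_le (((n : ℝ) + 1) * x)
      field_simp
      linarith
    refine tendsto_of_tendsto_of_tendsto_of_le_of_le tendsto_const_nhds ?_ hge hle
    simpa using (tendsto_one_div_add_atTop_nhds_zero_nat (𝕜 := ℝ)).const_add x

theorem frequently_nhdsGT_of_ae {p : ℝ → Prop} (hp : ∀ᵐ y : ℝ, p y) (x : ℝ) :
    ∃ᶠ y in 𝓝[>] x, p y := by
  intro h
  obtain ⟨u, hu, hu'⟩ := mem_nhdsGT_iff_exists_Ioo_subset.1 h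
  have hu : x < u := hu
  have := measure_mono_null (fun y hy => hu' hy) (ae_iff.1 hp)
  rw [Real.volume_Ioo, ENNReal.ofReal_eq_zero] at this
  linarith

theorem mem_of_ae_mem_of_rightContinuous {β : Type*} [TopologicalSpace β] {D : ℝ → β} {a b : ℝ}
    {s : Set β} (hs : IsClosed s) (hD : ∀ x ∈ Ioo a b, ContinuousWithinAt D (Ioi x) x)
    (h : ∀ᵐ x : ℝ, x ∈ Ioo a b → D x ∈ s) {x : ℝ} (hx : x ∈ Ioo a b) : D x ∈ s := by
  refine hs.mem_of_frequently_of_tendsto ?_ (hD x hx)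
  refine ((frequently_nhdsGT_of_ae h x).and_eventually (Ioo_mem_nhdsGT hx.2)).mono ?_
  exact fun y hy => hy.1 ⟨hx.1.trans hy.2.1, hy.2.2⟩

/-- Membership in a closed set extends from almost every point to every point by right continuity,
so it suffices that the target filter has a base of closed sets. -/
theorem tendsto_nhdsGT_of_tendsto_ae {β : Type*} [TopologicalSpace β] {D : ℝ → β} {l : Filter β}
    (hl : ∀ s ∈ l, ∃ t ∈ l, IsClosed t ∧ t ⊆ s)
    (hD : ∀ x, 0 < x → ContinuousWithinAt D (Ioi x) x)
    (h : Tendsto D (𝓝[>] 0 ⊓ ae volume) l) : Tendsto D (𝓝[>] 0) l := by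
  intro s hs
  obtain ⟨t, ht, htc, hts⟩ := hl s hs
  obtain ⟨u, hu, v, hv, huv⟩ := mem_inf_iff_superset.1 (h ht)
  obtain ⟨c, hc, hc'⟩ := mem_nhdsGT_iff_exists_Ioo_subset.1 hu
  refine mem_map.2 ?_
  filter_upwards [Ioo_mem_nhdsGT hc] with x hx
  refine hts (mem_of_ae_mem_of_rightContinuous htc (fun y hy => hD y hy.1) ?_ hx)
  filter_upwards [hv] with y hy hyc
  exact huv ⟨hc' hyc, hy⟩

instance neBot_nhdsGT_inf_ae : (𝓝[>] (0:ℝ) ⊓ ae volume).NeBot := by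
  refine inf_neBot_iff.2 fun s hs t ht => ?_
  obtain ⟨y, hy⟩ := ((frequently_nhdsGT_of_ae ht 0).and_eventually hs).exists
  exact ⟨y, hy.2, hy.1⟩

/-! ### Convolutions and kernels near zero. -/

theorem setLIntegral_ne_top_of_lap {f : ℝ → ℝ≥0∞} {b : ℝ} (hb : 0 ≤ b) (hf : lap f b ≠ ⊤) :
    ∫⁻ x in Ioo 0 1, f x ≠ ⊤ := by
  have h1 : ∫⁻ x in Ioo 0 1, f x ≤ ENNReal.ofReal (Real.exp b) * lap f b := by
    rw [lap, ← lintegral_const_mul' _ _ ENNReal.ofReal_ne_top]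
    refine (setLIntegral_mono' measurableSet_Ioo fun x hx => ?_).trans
      (lintegral_mono_set Ioo_subset_Ioi_self)
    rw [← mul_assoc, ← ENNReal.ofReal_mul (Real.exp_pos _).le, ← Real.exp_add]
    have : 1 ≤ ENNReal.ofReal (Real.exp (b + -b * x)) := by
      rw [ENNReal.one_le_ofReal, Real.one_le_exp_iff]
      nlinarith [hx.2]
    calc f x = 1 * f x := (one_mul _).symm
      _ ≤ _ := by gcongr
  exact ne_top_of_le_ne_top (ENNReal.mul_ne_top ENNReal.ofReal_ne_top hf) h1

theorem tendsto_setLIntegral_Ioo_zero {f : ℝ → ℝ≥0∞} {b : ℝ} (hb : 0 ≤ b) (hf : lap f b ≠ ⊤) :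
    Tendsto (fun x => ∫⁻ y in Ioo 0 x, f y) (𝓝[>] 0) (𝓝 0) := by
  have hv : Tendsto (fun x : ℝ => (volume.restrict (Ioo (0:ℝ) 1)) (Ioo 0 x)) (𝓝[>] 0) (𝓝 0) := by
    have h1 : Tendsto (fun x : ℝ => ENNReal.ofReal (x - 0)) (𝓝[>] 0) (𝓝 0) := by
      rw [← ENNReal.ofReal_zero]
      refine ENNReal.tendsto_ofReal ?_
      simp only [sub_zero]
      exact nhdsWithin_le_nhds
    refine tendsto_of_tendsto_of_tendsto_of_le_of_le tendsto_const_nhds h1 (fun _ => zero_le)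
      fun x => ?_
    exact (Measure.restrict_apply_le _ _).trans_eq Real.volume_Ioo
  refine (tendsto_setLIntegral_zero (setLIntegral_ne_top_of_lap hb hf) hv).congr' ?_
  filter_upwards [Ioo_mem_nhdsGT (one_pos : (0:ℝ) < 1)] with x hx
  rw [Measure.restrict_restrict measurableSet_Ioo, inter_eq_left.2 (Ioo_subset_Ioo_right hx.2.le)]

theorem lconv_comm (f g : ℝ → ℝ≥0∞) (x : ℝ) : lconv f g x = lconv g f x := by
  rw [lconv_eq, lconv_eq, ← lintegral_sub_left_eq_self _ x]
  refine lintegral_congr fun y => ?_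
  rw [sub_sub_cancel, mul_comm]

theorem lconv_le_mul {f g : ℝ → ℝ≥0∞} {C : ℝ≥0∞} (hf : Measurable f) {x : ℝ}
    (hg : ∀ y ∈ Ioo 0 x, g y ≤ C) :
    lconv f g x ≤ C * ∫⁻ y in Ioo 0 x, f y := by
  rw [← lintegral_const_mul _ hf]
  refine setLIntegral_mono' measurableSet_Ioo fun y hy => ?_
  rw [mul_comm]
  have := hg (x - y) ⟨by linarith [hy.2], by linarith [hy.1]⟩
  gcongr

theorem mul_le_lconv {f g : ℝ → ℝ≥0∞} {C : ℝ≥0∞} (hf : Measurable f) {x : ℝ}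
    (hg : ∀ y ∈ Ioo 0 x, C ≤ g y) :
    C * ∫⁻ y in Ioo 0 x, f y ≤ lconv f g x := by
  rw [← lintegral_const_mul _ hf]
  refine setLIntegral_mono' measurableSet_Ioo fun y hy => ?_
  rw [mul_comm]
  have := hg (x - y) ⟨by linarith [hy.2], by linarith [hy.1]⟩
  gcongr

theorem tendsto_average {g : ℝ → ℝ≥0∞} {c : ℝ≥0∞} (hg : Tendsto g (𝓝[>] 0) (𝓝 c)) :
    Tendsto (fun x => (∫⁻ y in Ioo 0 x, g y) / ENNReal.ofReal x) (𝓝[>] 0) (𝓝 c) := by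
  have hc : ∀ (p : ℝ≥0∞) (x : ℝ), 0 < x → (∫⁻ _ in Ioo 0 x, p) / ENNReal.ofReal x = p := by
    intro p x hx
    rw [setLIntegral_const, Real.volume_Ioo, sub_zero]
    exact ENNReal.mul_div_cancel_right (by simpa using hx) ENNReal.ofReal_ne_top
  refine tendsto_order.2 ⟨fun p hp => ?_, fun p hp => ?_⟩
  · obtain ⟨p', hp1, hp2⟩ := exists_between hp
    obtain ⟨u, hu, hu'⟩ := mem_nhdsGT_iff_exists_Ioo_subset.1 (hg.eventually_const_lt hp2)
    filter_upwards [Ioo_mem_nhdsGT hu] with x hx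
    refine hp1.trans_le ?_
    rw [← hc p' x hx.1]
    refine ENNReal.div_le_div_right (setLIntegral_mono' measurableSet_Ioo fun y hy => ?_) _
    exact le_of_lt (hu' ⟨hy.1, hy.2.trans hx.2⟩)
  · obtain ⟨p', hp1, hp2⟩ := exists_between hp
    obtain ⟨u, hu, hu'⟩ := mem_nhdsGT_iff_exists_Ioo_subset.1 (hg.eventually_lt_const hp1)
    filter_upwards [Ioo_mem_nhdsGT hu] with x hx
    refine lt_of_le_of_lt ?_ hp2
    rw [← hc p' x hx.1]
    refine ENNReal.div_le_div_right (setLIntegral_mono' measurableSet_Ioo fun y hy => ?_) _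
    exact le_of_lt (hu' ⟨hy.1, hy.2.trans hx.2⟩)

theorem tendsto_tail_zero (P : Measure ℝ) : Tendsto (tail P) (𝓝[>] 0) (𝓝 (P (Iio 0))) := by
  refine tendsto_order.2 ⟨fun p hp => ?_, fun p hp => ?_⟩
  · have h1 : Tendsto (fun n : ℕ => P (Iio (-(1 / ((n : ℝ) + 2))))) atTop (𝓝 (P (Iio 0))) := by
      rw [← iUnion_Iio_truncation_level]
      exact tendsto_measure_iUnion_atTop
        fun n m hnm => Iio_subset_Iio (monotone_truncation_level hnm)
    obtain ⟨n, hn⟩ := (h1.eventually_const_lt hp).exists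
    filter_upwards [Ioo_mem_nhdsGT (show (0:ℝ) < 1 / ((n : ℝ) + 2) by positivity)] with x hx
    exact hn.trans_le (tail_antitone P hx.2.le)
  · filter_upwards [self_mem_nhdsWithin] with x hx
    have hx : (0:ℝ) < x := hx
    exact (measure_mono (Iio_subset_Iio (by linarith))).trans_lt hp

/-- At 0 the integrated tail is the integral of |x| over the small jumps. Monotone convergence shows
it is approached from the right. -/
theorem tendsto_integratedTail_zero {P : Measure ℝ}
    (huv : ∫⁻ x in Ioo (-1) 0, ENNReal.ofReal |x| ∂P = ⊤) :
    Tendsto (integratedTail P) (𝓝[>] 0) (𝓝 ⊤) := by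
  have h0 : integratedTail P 0 = ⊤ := by
    rw [← huv]
    refine setLIntegral_congr_fun measurableSet_Ioo fun x hx => ?_
    simp [abs_of_neg hx.2]
  have h1 : Tendsto (fun n : ℕ => integratedTail P (1 / ((n : ℝ) + 1))) atTop (𝓝 ⊤) := by
    rw [← h0]
    refine lintegral_tendsto_of_tendsto_of_monotone (fun n => by fun_prop) ?_ ?_
    · refine ae_of_all _ fun x n m hnm => ENNReal.ofReal_le_ofReal ?_
      have := Nat.one_div_le_one_div (α := ℝ) hnm
      linarith
    · refine ae_of_all _ fun x => ENNReal.tendsto_ofReal ?_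
      exact (tendsto_one_div_add_atTop_nhds_zero_nat (𝕜 := ℝ)).const_sub (-x)
  refine tendsto_order.2 ⟨fun p hp => ?_, fun p hp => absurd hp not_top_lt⟩
  obtain ⟨n, hn⟩ := (h1.eventually_const_lt hp).exists
  filter_upwards [Ioo_mem_nhdsGT (show (0:ℝ) < 1 / ((n : ℝ) + 1) by positivity)] with x hx
  exact hn.trans_le (integratedTail_antitone P hx.2.le)

/-- This is D = c(A - r) divided by cD, with r moved across so that no truncated subtraction occurs.
It is the transform of a renewal equation. -/
theorem renewal_algebra {A r : ℝ≥0∞} (hA : A ≠ ⊤) (hr : r ≠ ⊤) {c D : ℝ} (hc : 0 < c)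
    (hD : D = c * (A.toReal - r.toReal)) (hD0 : 0 < D) :
    A * ENNReal.ofReal (1 / D) = ENNReal.ofReal (1 / c) + r * ENNReal.ofReal (1 / D) := by
  have h1 : A = ENNReal.ofReal A.toReal := (ENNReal.ofReal_toReal hA).symm
  have h2 : r = ENNReal.ofReal r.toReal := (ENNReal.ofReal_toReal hr).symm
  rw [h1, h2, ← ENNReal.ofReal_mul ENNReal.toReal_nonneg,
    ← ENNReal.ofReal_mul ENNReal.toReal_nonneg, ← ENNReal.ofReal_add (by positivity) (by positivity)]
  congr 1
  have : A.toReal = D / c + r.toReal := by rw [hD]; field_simp; ring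
  rw [this]
  field_simp

/-! ### Renewal equations for the scale function. -/

namespace SpectrallyNegativeLevy

variable {X : SpectrallyNegativeLevy} {q : ℝ} {W : ℝ → ℝ}

instance sigmaFinite_jump (X : SpectrallyNegativeLevy) : SigmaFinite X.jump :=
  sigmaFinite_of_lintegral_min_sq X.jump_Ici X.lintegral_jump_lt_top

theorem laplaceExponent_eq (X : SpectrallyNegativeLevy) (b : ℝ) :
    X.laplaceExponent b = -X.mu * b + X.sigma ^ 2 / 2 * b ^ 2 + jumpExponent X.jump b := rfl

theorem IsScaleFunction.measurable (hW : X.IsScaleFunction q W) : Measurable W := by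
  refine measurable_of_rightContinuous fun x => ?_
  rcases le_or_gt 0 x with hx | hx
  · exact hW.rightContinuous x hx
  · refine ContinuousAt.continuousWithinAt ?_
    refine (continuousAt_const (y := (0:ℝ))).congr ?_
    filter_upwards [Iio_mem_nhds hx] with y hy
    exact (hW.eq_zero_of_neg y hy).symm

theorem IsScaleFunction.lap_eq (hW : X.IsScaleFunction q W) {b : ℝ} (hb : X.rightInverse q < b) :
    lap (fun x => ENNReal.ofReal (W x)) b = ENNReal.ofReal (1 / (X.laplaceExponent b - q)) := by
  rw [← hW.laplace_eq b hb, ofReal_integral_eq_lintegral_ofReal (hW.integrableOn b hb)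
    (ae_of_all _ fun x => mul_nonneg (Real.exp_pos _).le (hW.nonneg x))]
  refine lintegral_congr fun x => ?_
  rw [ENNReal.ofReal_mul (Real.exp_pos _).le]

theorem drift_pos (h0 : X.sigma = 0)
    (hbv : ∫⁻ x in Ioo (-1) 0, ENNReal.ofReal |x| ∂X.jump ≠ ⊤) : 0 < X.drift := by
  rcases X.not_monotone with h | h | h
  · exact absurd h0 h
  · exact absurd h hbv
  · exact h.1

theorem eventually_lt_laplaceExponent (X : SpectrallyNegativeLevy) (hq : 0 ≤ q) :
    ∀ᶠ b in atTop, q < X.laplaceExponent b := by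
  have h := X.lintegral_jump_lt_top
  by_cases h0 : X.sigma = 0
  · have he : ∀ b, X.laplaceExponent b = -X.mu * b + jumpExponent X.jump b := fun b => by
      rw [laplaceExponent_eq, h0]
      ring
    simp_rw [he]
    by_cases hbv : ∫⁻ x in Ioo (-1) 0, ENNReal.ofReal |x| ∂X.jump = ⊤
    · obtain ⟨b₀, -, hb₀⟩ := uv_mem_closure h hbv X.mu hq
      exact eventually_atTop.2 ⟨b₀, fun b hb => (hb₀ b hb).1⟩
    · exact eventually_lt_of_bv h hbv hq (drift_pos h0 hbv)
  · have hd : 0 < X.sigma ^ 2 / 2 := by positivity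
    have h1 := (ENNReal.tendsto_toReal ENNReal.zero_ne_top).comp (tendsto_lap_zero
      (measurable_kernelRight X.jump X.mu q) (lap_kernels h 0 X.mu hq one_pos).2.1)
    filter_upwards [h1.eventually_lt_const hd, eventually_gt_atTop 0] with b hb hb0
    have h2 := (lap_kernels h (X.sigma ^ 2 / 2) X.mu hq hb0).2.2
    have h3 : 0 ≤ (lap (kernelLeft X.jump X.mu) b).toReal := ENNReal.toReal_nonneg
    simp only [Function.comp_apply] at hb
    have := mul_pos (pow_pos hb0 2) (show 0 < X.sigma ^ 2 / 2 +
      (lap (kernelLeft X.jump X.mu) b).toReal - (lap (kernelRight X.jump X.mu q) b).toReal by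
        linarith)
    rw [laplaceExponent_eq]
    linarith

/-- Transforms are only compared at large arguments, so nothing is needed about Φ(q) beyond its
being a real number. -/
theorem exists_abscissa (X : SpectrallyNegativeLevy) (hq : 0 ≤ q) :
    ∃ b₀ > 0, ∀ b ≥ b₀, X.rightInverse q < b ∧ q < X.laplaceExponent b := by
  obtain ⟨b₀, hb₀⟩ := eventually_atTop.1 ((eventually_gt_atTop (X.rightInverse q)).and
    (X.eventually_lt_laplaceExponent hq))
  exact ⟨max b₀ 1, lt_max_of_lt_right one_pos, fun b hb => hb₀ b ((le_max_left _ _).trans hb)⟩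

/-- The renewal equation in the case of bounded variation. -/
theorem IsScaleFunction.renewal_bv (hW : X.IsScaleFunction q W) (hq : 0 ≤ q) (h0 : X.sigma = 0)
    (hbv : ∫⁻ x in Ioo (-1) 0, ENNReal.ofReal |x| ∂X.jump ≠ ⊤) :
    ∀ᵐ x : ℝ, 0 < x → ENNReal.ofReal X.drift * ENNReal.ofReal (W x) =
      1 + lconv (bvKernel X.jump q) (fun x => ENNReal.ofReal (W x)) x := by
  have h := X.lintegral_jump_lt_top
  have hWm := hW.measurable
  have hwm : Measurable fun x => ENNReal.ofReal (W x) := by fun_prop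
  have hk := measurable_bvKernel X.jump q
  have hδ := drift_pos h0 hbv
  obtain ⟨b₀, hb₀, hb⟩ := X.exists_abscissa hq
  have := ae_eq_of_lap_eq (b := b₀) (f := fun x => ENNReal.ofReal X.drift * ENNReal.ofReal (W x))
    (g := fun x => 1 + lconv (bvKernel X.jump q) (fun x => ENNReal.ofReal (W x)) x)
    (by fun_prop) (measurable_const.add (measurable_lconv hk hwm)) ?_ fun j => ?_
  · rwa [EventuallyEq, ae_restrict_iff' measurableSet_Ioi] at this
  · rw [lap_const_mul hwm, hW.lap_eq (hb _ le_rfl).1]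
    finiteness
  · have hbj := hb (b₀ + j) (by simp)
    have hbj0 : 0 < b₀ + j := by positivity
    obtain ⟨hk1, hk2⟩ := lap_bvKernel h hbv X.mu hq hbj0
    rw [lap_const_mul hwm, lap_add measurable_const, lap_lconv hk hwm, hW.lap_eq hbj.1,
      lap_one hbj0]
    refine renewal_algebra ENNReal.ofReal_ne_top hk1 hbj0 ?_ (sub_pos.2 hbj.2)
    rw [ENNReal.toReal_ofReal hδ.le, drift, ← hk2, laplaceExponent_eq, h0]
    ring

/-- The renewal equation in the general case. -/
theorem IsScaleFunction.renewal (hW : X.IsScaleFunction q W) (hq : 0 ≤ q) :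
    ∀ᵐ x : ℝ, 0 < x → ENNReal.ofReal (X.sigma ^ 2 / 2) * ENNReal.ofReal (W x) +
        lconv (kernelLeft X.jump X.mu) (fun x => ENNReal.ofReal (W x)) x =
      ENNReal.ofReal x + lconv (kernelRight X.jump X.mu q) (fun x => ENNReal.ofReal (W x)) x := by
  have h := X.lintegral_jump_lt_top
  have hWm := hW.measurable
  have hwm : Measurable fun x => ENNReal.ofReal (W x) := by fun_prop
  have hL := measurable_kernelLeft X.jump X.mu
  have hR := measurable_kernelRight X.jump X.mu q
  have hd : 0 ≤ X.sigma ^ 2 / 2 := by positivity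
  obtain ⟨b₀, hb₀, hb⟩ := X.exists_abscissa hq
  have hlap : ∀ b ≥ b₀, lap (fun x => ENNReal.ofReal (X.sigma ^ 2 / 2) * ENNReal.ofReal (W x) +
        lconv (kernelLeft X.jump X.mu) (fun x => ENNReal.ofReal (W x)) x) b =
      (ENNReal.ofReal (X.sigma ^ 2 / 2) + lap (kernelLeft X.jump X.mu) b) *
        ENNReal.ofReal (1 / (X.laplaceExponent b - q)) := by
    intro b hbb
    rw [lap_add (by fun_prop), lap_const_mul hwm, lap_lconv hL hwm, hW.lap_eq (hb b hbb).1, add_mul]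
  have := ae_eq_of_lap_eq (b := b₀)
    (f := fun x => ENNReal.ofReal (X.sigma ^ 2 / 2) * ENNReal.ofReal (W x) +
        lconv (kernelLeft X.jump X.mu) (fun x => ENNReal.ofReal (W x)) x)
    (g := fun x => ENNReal.ofReal x +
      lconv (kernelRight X.jump X.mu q) (fun x => ENNReal.ofReal (W x)) x)
    ((hwm.const_mul _).add (measurable_lconv hL hwm))
    (ENNReal.measurable_ofReal.add (measurable_lconv hR hwm)) ?_ fun j => ?_
  · rwa [EventuallyEq, ae_restrict_iff' measurableSet_Ioi] at this
  · rw [hlap b₀ le_rfl]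
    have := (lap_kernels h (X.sigma ^ 2 / 2) X.mu hq hb₀).1
    finiteness
  · have hbj := hb (b₀ + j) (by simp)
    have hbj0 : 0 < b₀ + j := by positivity
    obtain ⟨hk1, hk2, hk3⟩ := lap_kernels h (X.sigma ^ 2 / 2) X.mu hq hbj0
    rw [hlap _ (by simp), lap_add ENNReal.measurable_ofReal, lap_lconv hR hwm, hW.lap_eq hbj.1,
      lap_ofReal hbj0]
    refine renewal_algebra (by finiteness) hk2 (by positivity) ?_ (sub_pos.2 hbj.2)
    rw [ENNReal.toReal_add (by finiteness) hk1, ENNReal.toReal_ofReal hd, ← hk3, laplaceExponent_eq]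

/-! ### The difference quotient at zero, and the case of bounded variation. -/

theorem IsScaleFunction.tendsto_zero (hW : X.IsScaleFunction q W) :
    Tendsto W (𝓝[>] 0) (𝓝 (W 0)) :=
  (hW.rightContinuous 0 le_rfl).mono_left (nhdsWithin_mono _ Ioi_subset_Ici_self)

/-- It suffices to control the difference quotient almost everywhere. -/
theorem IsScaleFunction.tendsto_quotient_of_ae (hW : X.IsScaleFunction q W) {l : Filter ℝ}
    (hl : ∀ s ∈ l, ∃ t ∈ l, IsClosed t ∧ t ⊆ s)
    (h : Tendsto (fun x => (W x - W 0) / x) (𝓝[>] 0 ⊓ ae volume) l) :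
    Tendsto (fun x => (W x - W 0) / x) (𝓝[>] 0) l := by
  refine tendsto_nhdsGT_of_tendsto_ae hl (fun x hx => ?_) h
  have := (hW.rightContinuous x hx.le).mono Ioi_subset_Ici_self
  exact (this.sub continuousWithinAt_const).div continuousWithinAt_id hx.ne'

theorem exists_isClosed_mem_nhds_subset (L : ℝ) :
    ∀ s ∈ 𝓝 L, ∃ t ∈ 𝓝 L, IsClosed t ∧ t ⊆ s := fun _ => exists_mem_nhds_isClosed_subset

theorem exists_isClosed_mem_atTop_subset :
    ∀ s ∈ (atTop : Filter ℝ), ∃ t ∈ (atTop : Filter ℝ), IsClosed t ∧ t ⊆ s := fun s hs => by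
  obtain ⟨a, ha⟩ := mem_atTop_sets.1 hs
  exact ⟨Ici a, mem_atTop a, isClosed_Ici, fun x hx => ha x hx⟩

/-- The limit is taken in [0,∞], so finite and infinite Π are treated together. Nonnegativity of the
quotient is recorded because `ENNReal.ofReal` would hide negative values. -/
theorem IsScaleFunction.bv_limit (hW : X.IsScaleFunction q W) (hq : 0 ≤ q) (h0 : X.sigma = 0)
    (hbv : ∫⁻ x in Ioo (-1) 0, ENNReal.ofReal |x| ∂X.jump ≠ ⊤) :
    Tendsto (fun x => ENNReal.ofReal ((W x - W 0) / x)) (𝓝[>] 0 ⊓ ae volume)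
      (𝓝 (ENNReal.ofReal (1 / X.drift ^ 2) * (X.jump (Iio 0) + ENNReal.ofReal q))) ∧
    ∀ᶠ x in 𝓝[>] 0 ⊓ ae volume, 0 ≤ (W x - W 0) / x := by
  set w : ℝ → ℝ≥0∞ := fun x => ENNReal.ofReal (W x) with hw
  set k := bvKernel X.jump q with hk
  have hkm : Measurable k := measurable_bvKernel X.jump q
  have hwm : Measurable w := ENNReal.measurable_ofReal.comp hW.measurable
  have hδ := drift_pos h0 hbv
  have hw0 : Tendsto w (𝓝[>] 0) (𝓝 (ENNReal.ofReal (W 0))) := ENNReal.tendsto_ofReal hW.tendsto_zero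
  have hkl : Tendsto k (𝓝[>] 0) (𝓝 (X.jump (Iio 0) + ENNReal.ofReal q)) :=
    (tendsto_tail_zero X.jump).add tendsto_const_nhds
  have hkint := tendsto_setLIntegral_Ioo_zero zero_le_one
    (lap_bvKernel X.lintegral_jump_lt_top hbv X.mu hq one_pos).1
  have hren := hW.renewal_bv hq h0 hbv
  have hren' : ∀ᶠ x in 𝓝[>] 0 ⊓ ae volume, 0 < x ∧
      ENNReal.ofReal X.drift * ENNReal.ofReal (W x) = 1 + lconv k w x := by
    filter_upwards [mem_inf_of_left self_mem_nhdsWithin, mem_inf_of_right hren] with x hx h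
    exact ⟨hx, h hx⟩
  have hconv0 : Tendsto (lconv k w) (𝓝[>] 0) (𝓝 0) := by
    have hb := ENNReal.Tendsto.const_mul (a := ENNReal.ofReal (W 0) + 1) hkint
      (Or.inr (by finiteness))
    rw [mul_zero] at hb
    refine tendsto_of_tendsto_of_tendsto_of_le_of_le' tendsto_const_nhds hb
      (Eventually.of_forall fun _ => zero_le) ?_
    obtain ⟨u, hu, hu'⟩ := mem_nhdsGT_iff_exists_Ioo_subset.1 (hw0.eventually_lt_const
      (show ENNReal.ofReal (W 0) < ENNReal.ofReal (W 0) + 1 from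
        ENNReal.lt_add_right ENNReal.ofReal_ne_top one_ne_zero))
    filter_upwards [Ioo_mem_nhdsGT hu] with x hx
    exact lconv_le_mul hkm fun y hy => le_of_lt (hu' ⟨hy.1, hy.2.trans hx.2⟩)
  -- Both sides of the renewal equation are sent to 0 along the almost everywhere filter, where k∗W
  -- vanishes.
  have hW0 : X.drift * W 0 = 1 := by
    have h1 : Tendsto (fun x => ENNReal.ofReal X.drift * w x) (𝓝[>] 0 ⊓ ae volume)
        (𝓝 (ENNReal.ofReal X.drift * ENNReal.ofReal (W 0))) :=
      ENNReal.Tendsto.const_mul (hw0.mono_left inf_le_left) (Or.inr ENNReal.ofReal_ne_top)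
    have h2 : Tendsto (fun x => 1 + lconv k w x) (𝓝[>] 0 ⊓ ae volume) (𝓝 (1 + 0)) :=
      (hconv0.mono_left inf_le_left).const_add 1
    have h3 := tendsto_nhds_unique (h1.congr' (hren'.mono fun x hx => hx.2)) h2
    rw [add_zero, ← ENNReal.ofReal_mul hδ.le, ENNReal.ofReal_eq_one] at h3
    exact h3
  have hquot : ∀ᶠ x in 𝓝[>] 0 ⊓ ae volume, 0 ≤ (W x - W 0) / x ∧
      ENNReal.ofReal ((W x - W 0) / x) =
        ENNReal.ofReal (1 / X.drift) * (lconv k w x / ENNReal.ofReal x) := by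
    filter_upwards [hren'] with x hx
    obtain ⟨hx0, hx⟩ := hx
    have hfin : lconv k w x ≠ ⊤ := by
      intro htop
      rw [htop, add_top] at hx
      exact (by finiteness : ENNReal.ofReal X.drift * ENNReal.ofReal (W x) ≠ ⊤) hx
    lift lconv k w x to NNReal using hfin with c
    rw [← ENNReal.ofReal_mul hδ.le, ← ENNReal.ofReal_coe_nnreal, ← ENNReal.ofReal_one,
      ← ENNReal.ofReal_add zero_le_one c.coe_nonneg, ENNReal.ofReal_eq_ofReal_iff
      (mul_nonneg hδ.le (hW.nonneg x)) (by positivity)] at hx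
    have hc : (W x - W 0) / x = 1 / X.drift * (c / x) := by
      field_simp
      linarith
    rw [hc, ENNReal.ofReal_mul (by positivity), ENNReal.ofReal_div_of_pos hx0,
      ENNReal.ofReal_coe_nnreal]
    exact ⟨by positivity, rfl⟩
  have hW0pos : 0 < W 0 := pos_of_mul_pos_right (hW0 ▸ one_pos) hδ.le
  -- On (0,x) the kernel lies between k(x) and k(0+), so (k∗W)(x)/x is squeezed between these
  -- constants times the average of W.
  have hlim : Tendsto (fun x => lconv k w x / ENNReal.ofReal x) (𝓝[>] 0)
      (𝓝 ((X.jump (Iio 0) + ENNReal.ofReal q) * ENNReal.ofReal (W 0))) := by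
    have havg := tendsto_average hw0
    have hne : ENNReal.ofReal (W 0) ≠ 0 := by simpa using hW0pos
    refine tendsto_of_tendsto_of_tendsto_of_le_of_le'
      (ENNReal.Tendsto.mul hkl (Or.inr ENNReal.ofReal_ne_top) havg (Or.inl hne))
      (ENNReal.Tendsto.const_mul havg (Or.inl hne)) ?_ ?_
    · filter_upwards [self_mem_nhdsWithin] with x hx
      rw [← mul_div_assoc, lconv_comm]
      refine ENNReal.div_le_div_right (mul_le_lconv hwm fun y hy => ?_) _
      exact add_le_add_left (tail_antitone _ hy.2.le) _
    · filter_upwards [self_mem_nhdsWithin] with x hx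
      rw [← mul_div_assoc, lconv_comm]
      refine ENNReal.div_le_div_right (lconv_le_mul hwm fun y hy => ?_) _
      exact add_le_add_left (measure_mono (Iio_subset_Iio (by linarith [hy.1]))) _
  refine ⟨?_, hquot.mono fun x hx => hx.1⟩
  have h1 := ENNReal.Tendsto.const_mul (a := ENNReal.ofReal (1 / X.drift))
    (hlim.mono_left (inf_le_left : 𝓝[>] (0:ℝ) ⊓ ae volume ≤ _)) (Or.inr ENNReal.ofReal_ne_top)
  have hval : ENNReal.ofReal (1 / X.drift) *
      ((X.jump (Iio 0) + ENNReal.ofReal q) * ENNReal.ofReal (W 0)) =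
      ENNReal.ofReal (1 / X.drift ^ 2) * (X.jump (Iio 0) + ENNReal.ofReal q) := by
    rw [mul_comm (X.jump (Iio 0) + ENNReal.ofReal q), ← mul_assoc,
      ← ENNReal.ofReal_mul (by positivity), (eq_one_div_of_mul_eq_one_right hW0 : W 0 = _)]
    congr 2
    field_simp
  rw [← hval]
  exact h1.congr' (hquot.mono fun x hx => hx.2.symm)

end SpectrallyNegativeLevy

/-- R contains only a constant, the once integrated tail of the large jumps and qy, so it stays
bounded near 0. -/
theorem exists_kernelRight_le {P : Measure ℝ} [SFinite P]
    (h : ∫⁻ x, ENNReal.ofReal (min 1 (x ^ 2)) ∂P < ⊤) (mu q : ℝ) :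
    ∃ C : ℝ≥0∞, C ≠ ⊤ ∧ ∀ y ∈ Ioo 0 1, kernelRight P mu q y ≤ C := by
  have hT : ∫⁻ y in Ioo 0 1, tail (P.restrict (Iic (-1))) y ≠ ⊤ :=
    setLIntegral_ne_top_of_lap zero_le_one (by rw [lap_tail_large h one_pos]; finiteness)
  refine ⟨ENNReal.ofReal mu + ((∫⁻ y in Ioo 0 1, tail (P.restrict (Iic (-1))) y) +
    ENNReal.ofReal q * 1), by finiteness, fun y hy => ?_⟩
  unfold kernelRight
  gcongr
  · rw [lconv_comm]
    simp only [lconv, mul_one]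
    exact lintegral_mono_set (Ioo_subset_Ioo_right hy.2.le)
  · simpa using hy.2.le

/-! ### The Gaussian case. -/

namespace SpectrallyNegativeLevy

variable {X : SpectrallyNegativeLevy} {q : ℝ} {W : ℝ → ℝ}

/-- With d = σ²/2, the renewal equation gives |dW(z) - z| ≤ C J(x) for z ≤ x when W ≤ C on (0,x),
where J(x) is the integral of L + R over (0,x) and tends to 0. A first use gives W = O(x), and a
second gives the error o(x). -/
theorem IsScaleFunction.gaussian_bound (hW : X.IsScaleFunction q W) (hq : 0 ≤ q)
    (hσ : X.sigma ≠ 0) : ∃ I : ℝ → ℝ, Tendsto I (𝓝[>] 0) (𝓝 0) ∧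
      ∀ᶠ x in 𝓝[>] 0 ⊓ ae volume, 0 < x ∧ |W x - 2 / X.sigma ^ 2 * x| ≤ x * I x := by
  set w : ℝ → ℝ≥0∞ := fun x => ENNReal.ofReal (W x) with hw
  set L := kernelLeft X.jump X.mu
  set R := kernelRight X.jump X.mu q
  set d := X.sigma ^ 2 / 2 with hd
  have hd0 : 0 < d := by positivity
  have h := X.lintegral_jump_lt_top
  have hLm : Measurable L := measurable_kernelLeft X.jump X.mu
  have hRm : Measurable R := measurable_kernelRight X.jump X.mu q
  obtain ⟨hL1, hR1, -⟩ := lap_kernels h 0 X.mu hq one_pos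
  have hLint := tendsto_setLIntegral_Ioo_zero zero_le_one hL1
  have hRint := tendsto_setLIntegral_Ioo_zero zero_le_one hR1
  have hLR : Tendsto (fun x => (∫⁻ y in Ioo 0 x, L y) + ∫⁻ y in Ioo 0 x, R y) (𝓝[>] 0) (𝓝 0) := by
    simpa using hLint.add hRint
  set J : ℝ → ℝ≥0∞ := fun x => (∫⁻ y in Ioo 0 x, L y) + ∫⁻ y in Ioo 0 x, R y with hJ
  have hren := hW.renewal hq
  obtain ⟨u, hu, hu'⟩ := mem_nhdsGT_iff_exists_Ioo_subset.1 ((hW.tendsto_zero.eventually_lt_const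
    (show W 0 < W 0 + 1 by linarith)).and (hLR.eventually_lt_const
      (show (0 : ℝ≥0∞) < ENNReal.ofReal (d / 2) by simpa using hd0)))
  have hu : 0 < u := hu
  have hWlt : ∀ y ∈ Ioo 0 u, W y < W 0 + 1 := fun y hy => (hu' hy).1
  have hJlt : ∀ y ∈ Ioo 0 u, J y < ENNReal.ofReal (d / 2) := fun y hy => (hu' hy).2
  have hWcont : ∀ x, 0 < x → ContinuousWithinAt W (Ioi x) x := fun x hx =>
    (hW.rightContinuous x hx.le).mono Ioi_subset_Ici_self
  -- C and x are quantified inside, so a single exceptional null set serves all of them.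
  have hbound : ∀ᵐ z : ℝ, ∀ C : ℝ, 0 ≤ C → ∀ x ∈ Ioo 0 u, (∀ y ∈ Ioo 0 x, W y ≤ C) →
      z ∈ Ioc 0 x → |d * W z - z| ≤ C * (J x).toReal := by
    filter_upwards [hren] with z hz C hC x hx hWC hzx
    have hz := hz hzx.1
    have hsub : Ioo 0 z ⊆ Ioo 0 x := Ioo_subset_Ioo_right hzx.2
    have hJx : J x ≠ ⊤ := ((hJlt x hx).trans_le le_top).ne
    have hle : ∀ f : ℝ → ℝ≥0∞, Measurable f → (∫⁻ y in Ioo 0 x, f y) ≤ J x →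
        lconv f w z ≤ ENNReal.ofReal (C * (J x).toReal) := by
      intro f hf hfJ
      rw [ENNReal.ofReal_mul hC, ENNReal.ofReal_toReal hJx]
      refine (lconv_le_mul hf (C := ENNReal.ofReal C) fun y hy =>
        ENNReal.ofReal_le_ofReal (hWC y (hsub hy))).trans ?_
      have := (lintegral_mono_set hsub).trans hfJ
      gcongr
    have hLz := hle L hLm le_self_add
    have hRz := hle R hRm le_add_self
    have hCJ : 0 ≤ C * (J x).toReal := mul_nonneg hC ENNReal.toReal_nonneg
    rw [← ENNReal.ofReal_mul hd0.le] at hz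
    have h1 : ENNReal.ofReal (d * W z) ≤ ENNReal.ofReal (z + C * (J x).toReal) := by
      rw [ENNReal.ofReal_add hzx.1.le hCJ]
      exact (le_self_add.trans_eq hz).trans (by gcongr)
    have h2 : ENNReal.ofReal z ≤ ENNReal.ofReal (d * W z + C * (J x).toReal) := by
      rw [ENNReal.ofReal_add (mul_nonneg hd0.le (hW.nonneg z)) hCJ]
      exact (le_self_add.trans_eq hz.symm).trans (by gcongr)
    rw [ENNReal.ofReal_le_ofReal_iff (by linarith [hzx.1])] at h1
    rw [ENNReal.ofReal_le_ofReal_iff (add_nonneg (mul_nonneg hd0.le (hW.nonneg z)) hCJ)] at h2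
    exact abs_le.2 ⟨by linarith, by linarith⟩
  -- The supremum A of W over (0,x) is finite and satisfies dA ≤ x + A d/2, because J ≤ d/2 there.
  -- Absorbing the last term gives A ≤ 2x/d.
  have hlin : ∀ x ∈ Ioo 0 u, ∀ y ∈ Ioo 0 x, W y ≤ 2 / d * x := by
    intro x hx
    have hne : (W '' Ioo 0 x).Nonempty := ⟨_, mem_image_of_mem W ⟨half_pos hx.1, half_lt_self hx.1⟩⟩
    have hbdd : BddAbove (W '' Ioo 0 x) := by
      refine ⟨W 0 + 1, ?_⟩
      rintro _ ⟨y, hy, rfl⟩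
      exact (hWlt y ⟨hy.1, hy.2.trans hx.2⟩).le
    set A := sSup (W '' Ioo 0 x)
    have hWA : ∀ y ∈ Ioo 0 x, W y ≤ A := fun y hy => le_csSup hbdd (mem_image_of_mem W hy)
    have hA0 : 0 ≤ A := (hW.nonneg _).trans (hWA (x / 2) ⟨half_pos hx.1, half_lt_self hx.1⟩)
    have hJ2 : (J x).toReal ≤ d / 2 := by
      have := ENNReal.toReal_mono ENNReal.ofReal_ne_top (hJlt x hx).le
      rwa [ENNReal.toReal_ofReal (by positivity)] at this
    have hA : A ≤ (x + A * (d / 2)) / d := by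
      refine csSup_le hne ?_
      rintro _ ⟨y, hy, rfl⟩
      refine mem_of_ae_mem_of_rightContinuous isClosed_Iic (fun z hz => hWcont z hz.1) ?_ hy
      filter_upwards [hbound] with z hz hzx
      have h1 := (abs_le.1 (hz A hA0 x hx hWA ⟨hzx.1, hzx.2.le⟩)).2
      have h2 := mul_le_mul_of_nonneg_left hJ2 hA0
      rw [mem_Iic, le_div_iff₀ hd0]
      linarith [hzx.2]
    have hA' : A ≤ 2 / d * x := by
      rw [le_div_iff₀ hd0] at hA
      rw [div_mul_eq_mul_div, le_div_iff₀ hd0]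
      linarith
    exact fun y hy => (hWA y hy).trans hA'
  refine ⟨fun x => 2 / d ^ 2 * (J x).toReal, ?_, ?_⟩
  · simpa using ((ENNReal.tendsto_toReal ENNReal.zero_ne_top).comp hLR).const_mul (2 / d ^ 2)
  · filter_upwards [mem_inf_of_left (Ioo_mem_nhdsGT hu), mem_inf_of_right hbound] with x hx hb
    refine ⟨hx.1, ?_⟩
    have hx0 := hx.1
    have h1 := hb (2 / d * x) (by positivity) x hx (hlin x hx) ⟨hx.1, le_rfl⟩
    have h2 : W x - 2 / X.sigma ^ 2 * x = (d * W x - x) / d := by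
      rw [hd]
      field_simp
    rw [h2, abs_div, abs_of_pos hd0, div_le_iff₀ hd0]
    refine h1.trans_eq ?_
    field_simp

theorem IsScaleFunction.tendsto_gaussian (hW : X.IsScaleFunction q W) (hq : 0 ≤ q)
    (hσ : X.sigma ≠ 0) :
    Tendsto (fun x => (W x - W 0) / x) (𝓝[>] 0) (𝓝 (2 / X.sigma ^ 2)) := by
  obtain ⟨I, hI, hb⟩ := hW.gaussian_bound hq hσ
  have hI' := hI.mono_left (inf_le_left : 𝓝[>] (0:ℝ) ⊓ ae volume ≤ _)
  have hid : Tendsto (fun x : ℝ => x) (𝓝[>] 0 ⊓ ae volume) (𝓝 0) :=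
    inf_le_left.trans nhdsWithin_le_nhds
  have hW0 : W 0 = 0 := by
    have h1 : Tendsto (fun x => W x - 2 / X.sigma ^ 2 * x) (𝓝[>] 0 ⊓ ae volume) (𝓝 0) :=
      squeeze_zero_norm' (hb.mono fun x hx => hx.2) (by simpa using hid.mul hI')
    have h2 := h1.add (hid.const_mul (2 / X.sigma ^ 2))
    simp only [sub_add_cancel, mul_zero, add_zero] at h2
    exact tendsto_nhds_unique (hW.tendsto_zero.mono_left inf_le_left) h2
  refine hW.tendsto_quotient_of_ae (exists_isClosed_mem_nhds_subset _) ?_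
  rw [tendsto_iff_norm_sub_tendsto_zero]
  refine squeeze_zero' (Eventually.of_forall fun x => norm_nonneg _) ?_ hI'
  filter_upwards [hb] with x hx
  have h1 : (W x - W 0) / x - 2 / X.sigma ^ 2 = (W x - 2 / X.sigma ^ 2 * x) / x := by
    have := hx.1.ne'
    rw [hW0]
    field_simp
    ring
  rw [h1, norm_div, Real.norm_eq_abs, Real.norm_of_nonneg hx.1.le, div_le_iff₀ hx.1]
  linarith [hx.2]

/-! ### Unbounded variation without Gaussian component. -/

theorem IsScaleFunction.monotoneOn (hW : X.IsScaleFunction q W) (hq : 0 ≤ q) (h0 : X.sigma = 0)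
    (huv : ∫⁻ x in Ioo (-1) 0, ENNReal.ofReal |x| ∂X.jump = ⊤) : MonotoneOn W (Ici 0) := by
  obtain ⟨b₁, hb₁, hmem⟩ := uv_mem_closure X.lintegral_jump_lt_top huv X.mu hq
  obtain ⟨b₂, -, hb₂⟩ := X.exists_abscissa hq
  have hlap : ∀ b ≥ max b₁ b₂, lap (fun x => ENNReal.ofReal (W x)) b =
      ENNReal.ofReal (1 / (-X.mu * b + jumpExponent X.jump b - q)) := by
    intro b hb
    rw [hW.lap_eq (hb₂ b ((le_max_right _ _).trans hb)).1, laplaceExponent_eq, h0]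
    simp
  refine monotoneOn_of_mem_closure hW.measurable hW.rightContinuous (b := max b₁ b₂) ?_ hW.nonneg ?_
  · rw [hlap _ le_rfl]
    finiteness
  · simp_rw [fun j : ℕ => hlap (max b₁ b₂ + j) (by simp)]
    exact (hmem _ (le_max_left _ _)).2

theorem IsScaleFunction.tendsto_uv (hW : X.IsScaleFunction q W) (hq : 0 ≤ q) (h0 : X.sigma = 0)
    (huv : ∫⁻ x in Ioo (-1) 0, ENNReal.ofReal |x| ∂X.jump = ⊤) :
    Tendsto (fun x => (W x - W 0) / x) (𝓝[>] 0) atTop := by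
  set w : ℝ → ℝ≥0∞ := fun x => ENNReal.ofReal (W x) with hw
  set L := kernelLeft X.jump X.mu
  set R := kernelRight X.jump X.mu q
  have h := X.lintegral_jump_lt_top
  have hLm : Measurable L := measurable_kernelLeft X.jump X.mu
  have hRm : Measurable R := measurable_kernelRight X.jump X.mu q
  obtain ⟨hL1, hR1, -⟩ := lap_kernels h 0 X.mu hq one_pos
  have hLint := tendsto_setLIntegral_Ioo_zero zero_le_one hL1
  have hmono := hW.monotoneOn hq h0 huv
  have hwle : ∀ x, ∀ y ∈ Ioo 0 x, w y ≤ w x := fun x y hy =>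
    ENNReal.ofReal_le_ofReal (hmono hy.1.le (hy.1.trans hy.2).le hy.2.le)
  have hren : ∀ᶠ x in 𝓝[>] 0 ⊓ ae volume, 0 < x ∧
      lconv L w x = ENNReal.ofReal x + lconv R w x := by
    filter_upwards [mem_inf_of_left self_mem_nhdsWithin, mem_inf_of_right (hW.renewal hq)] with x hx h
    refine ⟨hx, ?_⟩
    simpa [h0] using h hx
  -- If W(0) > 0, then W(0)∫₀ˣL ≤ (L∗W)(x) ≤ x + C∫₀ˣW. After division by x the left side tends to ∞
  -- because L(0+) = ∞, while the right side stays bounded.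
  have hW0 : W 0 = 0 := by
    by_contra hne
    have hpos : 0 < W 0 := lt_of_le_of_ne (hW.nonneg 0) (Ne.symm hne)
    have hLavg : Tendsto (fun x => (∫⁻ y in Ioo 0 x, L y) / ENNReal.ofReal x) (𝓝[>] 0) (𝓝 ⊤) := by
      have h1 := (tendsto_integratedTail_zero huv).add_const (ENNReal.ofReal (-X.mu))
      rw [top_add] at h1
      exact tendsto_average h1
    obtain ⟨C, hC, hRC⟩ := exists_kernelRight_le h X.mu q
    have hlim1 := ENNReal.Tendsto.const_mul (a := w 0)
      (hLavg.mono_left (inf_le_left : 𝓝[>] (0:ℝ) ⊓ ae volume ≤ _)) (Or.inl ENNReal.top_ne_zero)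
    rw [ENNReal.mul_top (by simpa [w] using hpos)] at hlim1
    have hwavg := (tendsto_average (ENNReal.tendsto_ofReal hW.tendsto_zero)).mono_left
      (inf_le_left : 𝓝[>] (0:ℝ) ⊓ ae volume ≤ _)
    have hlim2 := (ENNReal.Tendsto.const_mul (a := C) hwavg (Or.inr hC)).const_add 1
    have hle := le_of_tendsto_of_tendsto hlim1 hlim2 ?_
    · exact (by finiteness : 1 + C * ENNReal.ofReal (W 0) ≠ ⊤) (top_le_iff.1 hle)
    · filter_upwards [hren, mem_inf_of_left (Ioo_mem_nhdsGT one_pos)] with x hx hx1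
      have hlow : w 0 * ∫⁻ y in Ioo 0 x, L y ≤ lconv L w x := mul_le_lconv hLm fun y hy =>
        ENNReal.ofReal_le_ofReal (hmono (mem_Ici.2 le_rfl) hy.1.le hy.1.le)
      have hup : lconv R w x ≤ C * ∫⁻ y in Ioo 0 x, w y := by
        rw [lconv_comm]
        exact lconv_le_mul (ENNReal.measurable_ofReal.comp hW.measurable) fun y hy =>
          hRC y ⟨hy.1, hy.2.trans hx1.2⟩
      rw [hx.2] at hlow
      have := ENNReal.div_le_div_right (hlow.trans (add_le_add_right hup _)) (ENNReal.ofReal x)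
      rwa [ENNReal.add_div, ENNReal.div_self (by simpa using hx.1) ENNReal.ofReal_ne_top,
        mul_div_assoc, mul_div_assoc] at this
  have hquot : Tendsto (fun x => ENNReal.ofReal ((W x - W 0) / x)) (𝓝[>] 0 ⊓ ae volume) (𝓝 ⊤) := by
    have hinv : Tendsto (fun x => (∫⁻ y in Ioo 0 x, L y)⁻¹) (𝓝[>] 0 ⊓ ae volume) (𝓝 ⊤) := by
      rw [← ENNReal.inv_zero]
      exact (hLint.mono_left inf_le_left).inv
    refine tendsto_of_tendsto_of_tendsto_of_le_of_le' hinv tendsto_const_nhds ?_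
      (Eventually.of_forall fun x => le_top)
    filter_upwards [hren] with x hx
    -- Monotonicity bounds W by W(x) inside the convolution, so W(x)/x is at least the inverse of
    -- ∫₀ˣL, which tends to ∞.
    have h1 : ENNReal.ofReal x ≤ w x * ∫⁻ y in Ioo 0 x, L y :=
      (le_self_add.trans_eq hx.2.symm).trans (lconv_le_mul hLm (hwle x))
    rw [hW0, sub_zero, ENNReal.ofReal_div_of_pos hx.1]
    rw [ENNReal.le_div_iff_mul_le (Or.inl (by simpa using hx.1)) (Or.inl ENNReal.ofReal_ne_top)]
    rw [mul_comm, ← div_eq_mul_inv]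
    exact ENNReal.div_le_of_le_mul h1
  exact hW.tendsto_quotient_of_ae exists_isClosed_mem_atTop_subset
    (ENNReal.tendsto_ofReal_nhds_top.1 hquot)

end SpectrallyNegativeLevy

end

theorem mainTheorem7 (X : SpectrallyNegativeLevy) (q : ℝ) (hq : 0 ≤ q) (W : ℝ → ℝ)
    (hW : X.IsScaleFunction q W) :
    (X.sigma ≠ 0 →
      Tendsto (fun x => (W x - W 0) / x) (𝓝[>] 0) (𝓝 (2 / X.sigma ^ 2))) ∧
    (X.sigma = 0 → X.jump (Iio 0) = ⊤ →
      Tendsto (fun x => (W x - W 0) / x) (𝓝[>] 0) atTop) ∧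
    (X.sigma = 0 → X.jump (Iio 0) < ⊤ →
      Tendsto (fun x => (W x - W 0) / x) (𝓝[>] 0)
        (𝓝 (((X.jump (Iio 0)).toReal + q) / X.drift ^ 2))) := by
  refine ⟨hW.tendsto_gaussian hq, fun h0 htop => ?_, fun h0 hfin => ?_⟩
  -- Infinitely many jumps may still have bounded variation. In that case the limit in [0,∞] of
  -- `bv_limit` is already infinite.
  · by_cases hbv : ∫⁻ x in Ioo (-1) 0, ENNReal.ofReal |x| ∂X.jump = ⊤
    · exact hW.tendsto_uv hq h0 hbv
    · have hlim := (hW.bv_limit hq h0 hbv).1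
      have hδ := SpectrallyNegativeLevy.drift_pos h0 hbv
      rw [htop, top_add, ENNReal.mul_top (by simpa using hδ.ne'),
        ENNReal.tendsto_ofReal_nhds_top] at hlim
      exact hW.tendsto_quotient_of_ae
        SpectrallyNegativeLevy.exists_isClosed_mem_atTop_subset hlim
  · have hbv := lintegral_abs_ne_top hfin
    obtain ⟨hlim, hnn⟩ := hW.bv_limit hq h0 hbv
    have hδ := SpectrallyNegativeLevy.drift_pos h0 hbv
    refine hW.tendsto_quotient_of_ae
      (SpectrallyNegativeLevy.exists_isClosed_mem_nhds_subset _) ?_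
    have h1 := (ENNReal.tendsto_toReal (by finiteness)).comp hlim
    rw [ENNReal.toReal_mul, ENNReal.toReal_add hfin.ne ENNReal.ofReal_ne_top,
      ENNReal.toReal_ofReal hq, ENNReal.toReal_ofReal (by positivity), one_div_mul_eq_div] at h1
    exact h1.congr' (hnn.mono fun x hx => ENNReal.toReal_ofReal hx)
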